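/- Consider the singularly perturbed system \[ \dot x=\rho_s(x,z,d)\,g_s(x,z,d),\qquad \dot z=\rho_f(z,x,w)\,g_f(z,x,w), \] with states $x\in\mathbb R^n$, $z\in\mathbb R^m$ and inputs $d\in\mathbb R^p$, $w\in\mathbb R^q$, where $g_s$ and $g_f$ are locally Lipschitz in $(x,z)$ (locally uniformly in the input), and measurable and locally bounded in $d$, respectively in $w$. Here $|\cdot|$ is the Euclidean norm; $\mathcal K$ is the class of continuous strictly increasing functions on $[0,\infty)$ vanishing at $0$, $\mathcal K_\infty$ the class of unbounded functions in $\mathcal K$, $\mathcal{PD}$ the class of continuous functions on $[0,\infty)$ vanishing at $0$ and positive on $(0,\infty)$, and $\mathcal{KL}$ the class of continuous $\beta:[0,\infty)^2\to[0,\infty)$ with $\beta(\cdot,t)\in\mathcal K$ for all $t\ge 0$ and $\beta(s,\cdot)$ decreasing to $0$ for all $s>0$. Assume: (1) There is a locally Lipschitz map $\varphi:\mathbb R^n\to\mathbb R^m$ with $g_s(0,\varphi(0),0)=0$ and $g_f(\varphi(x),x,0)=0$ for all $x$. (2) There are continuously differentiable $V_s:\mathbb R^n\to[0,\infty)$ and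 $V_f:\mathbb R^m\times\mathbb R^n\to[0,\infty)$, functions $\underline\alpha_s,\overline\alpha_s,\gamma_s,\chi_s,\underline\alpha_f,\overline\alpha_f,\chi_f\in\mathcal K_\infty$ and $\alpha_s,\alpha_f,\lambda_{f1},\lambda_{f2}\in\mathcal{PD}$, with $\lambda_{f2}$ nondecreasing, such that for all $x,z,d,w$ \[ \underline\alpha_s(|x|)\le V_s(x)\le\overline\alpha_s(|x|),\qquad V_s(x)\ge\max\{\gamma_s(V_f(z,x)),\chi_s(|d|)\}\ \Rightarrow\ \frac{\partial V_s(x)}{\partial x}g_s(x,z,d)\le-\alpha_s(V_s(x)), \] \[ \underline\alpha_f(|z-\varphi(x)|)\le V_f(z,x)\le\overline\alpha_f(|z-\varphi(x)|),\qquad V_f(z,x)\ge\chi_f(|w|)\ \Rightarrow\ \frac{\partial V_f(z,x)}{\partial z}g_f(z,x,w)\le-\alpha_f(V_f(z,x)), \] \[ \left|\frac{\partial V_f(z,x)}{\partial x}\right|\le\lambda_{f1}(V_f(z,x))+\lambda_{f2}(V_s(x)). \] Let $\breve g_s\in\mathcal K_\infty$ satisfy $|g_s(x,z,d)|\le\breve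 g_s(|x|+|z-\varphi(x)|+|d|)$ for all $x,z,d$, and for $r\ge 0$ set \[ \bar g_s(r)=\breve g_s\big(\underline\alpha_s^{-1}(\gamma_s(r))+\underline\alpha_f^{-1}(r)+\gamma_s(\chi_s^{-1}(r))\big),\qquad \bar\lambda_f(r)=\lambda_{f1}(r)+\lambda_{f2}(\gamma_s(r)). \] Suppose that a constant $c_0>0$ satisfies $c_0\,\bar g_s(r)\,\bar\lambda_f(r)<\alpha_f(r)$ for all $r>0$, and let $\rho_s\equiv c_s$ and $\rho_f\equiv c_f$ with constants $c_s,c_f>0$ such that $c_s/c_f=c_0$. Then the system is input-to-state stable with $(x,z-\varphi(0))$ as the state and $(d,w)$ as the input: there are $\beta\in\mathcal{KL}$ and $\chi\in\mathcal K$ such that for every initial state and every measurable, locally essentially bounded input $u=(d,w)$ a solution exists on $[0,\infty)$, and every solution, with $\xi(t)=(x(t),z(t)-\varphi(0))$, satisfies \[ |\xi(t)|\le\max\{\beta(|\xi(0)|,t),\ \chi(\|u\|_\infty)\}\qquad\text{for all }t\ge 0 \] (the estimate being void when $\|u\|_\infty=\infty$). -/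

import Mathlib

open Set Filter Topology MeasureTheory

/-- Euclidean space of dimension `n`. -/
abbrev Euc (n : ℕ) : Type := EuclideanSpace ℝ (Fin n)

/-! ### Comparison functions

A function on the nonnegative reals is represented by a function `ℝ → ℝ` of which only the values
on `[0, ∞)` matter. -/

/-- Class `PD`: continuous on `[0, ∞)`, zero at zero, positive on `(0, ∞)`. -/
structure IsClassPD (α : ℝ → ℝ) : Prop where
  continuousOn : ContinuousOn α (Ici 0)
  map_zero : α 0 = 0
  pos : ∀ r, 0 < r → 0 < α r

/-- Class `K`: continuous and strictly increasing on `[0, ∞)`, zero at zero. -/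
structure IsClassK (α : ℝ → ℝ) : Prop where
  continuousOn : ContinuousOn α (Ici 0)
  map_zero : α 0 = 0
  strictMonoOn : StrictMonoOn α (Ici 0)

/-- Class `K∞`: of class `K` and unbounded. -/
structure IsClassKInf (α : ℝ → ℝ) : Prop extends IsClassK α where
  unbounded : ∀ M : ℝ, ∃ r, 0 ≤ r ∧ M ≤ α r

/-- Class `KL`. -/
structure IsClassKL (β : ℝ → ℝ → ℝ) : Prop where
  continuousOn : ContinuousOn (Function.uncurry β) (Ici 0 ×ˢ Ici 0)
  classK : ∀ t, 0 ≤ t → IsClassK fun s => β s t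
  antitoneOn : ∀ s, 0 < s → AntitoneOn (β s) (Ici 0)
  tendsto_zero : ∀ s, 0 < s → Tendsto (β s) atTop (𝓝 0)

/-- The inverse on `[0, ∞)` of a function of class `K∞`. -/
noncomputable def kInv (α : ℝ → ℝ) : ℝ → ℝ :=
  Function.invFunOn α (Ici 0)

/-- A function of class `K∞` maps `[0, ∞)` bijectively onto itself. -/
theorem IsClassKInf.bijOn {α : ℝ → ℝ} (h : IsClassKInf α) : BijOn α (Ici 0) (Ici 0) := by
  refine ⟨fun r hr => ?_, h.strictMonoOn.injOn, fun y hy => ?_⟩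
  · have := h.strictMonoOn.monotoneOn (self_mem_Ici (a := (0 : ℝ))) hr hr
    rwa [h.map_zero] at this
  · obtain ⟨r, hr, hyr⟩ := h.unbounded y
    have hsub : Icc 0 r ⊆ Ici (0 : ℝ) := fun s hs => hs.1
    have := intermediate_value_Icc hr (h.continuousOn.mono hsub)
    rw [h.map_zero] at this
    obtain ⟨s, hs, hs'⟩ := this ⟨hy, hyr⟩
    exact ⟨s, hs.1, hs'⟩

/-- `kInv α` is the genuine two-sided inverse of a function `α` of class `K∞` on `[0, ∞)`. -/
theorem IsClassKInf.invOn_kInv {α : ℝ → ℝ} (h : IsClassKInf α) :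
    InvOn (kInv α) α (Ici 0) (Ici 0) :=
  h.bijOn.invOn_invFunOn

/-! ### Systems with inputs and input-to-state stability -/

section Systems

variable {X U : Type*} [NormedAddCommGroup X] [NormedSpace ℝ X] [NormedAddCommGroup U]

/-- Admissible inputs: (Lebesgue) measurable and locally essentially bounded on `[0, ∞)`. -/
def IsInput (u : ℝ → U) : Prop :=
  AEStronglyMeasurable u (volume.restrict (Ici 0)) ∧
    ∀ T : ℝ, eLpNorm u ⊤ (volume.restrict (Icc 0 T)) < ⊤

/-- The essential supremum norm over `[0, ∞)` of an input, possibly infinite. -/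
noncomputable def inputNorm (u : ℝ → U) : ENNReal :=
  eLpNorm u ⊤ (volume.restrict (Ici 0))

/-- `ξ` is a (Carathéodory) solution on `[0, ∞)` of `ξ' = f (ξ, u)`, `ξ 0 = ξ₀`. -/
def IsSolution (f : X → U → X) (u : ℝ → U) (ξ₀ : X) (ξ : ℝ → X) : Prop :=
  ContinuousOn ξ (Ici 0) ∧
    ∀ t, 0 ≤ t → IntervalIntegrable (fun s => f (ξ s) (u s)) volume 0 t ∧
      ξ t = ξ₀ + ∫ s in (0 : ℝ)..t, f (ξ s) (u s)

/-- Input-to-state stability of `ξ' = f (ξ, u)` with `ξ - ξₑ` as the state and `u` as the input.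
The solutions exist on all of `[0, ∞)` for every admissible input; the estimate has a content
for inputs of finite essential supremum norm. -/
def IsISS (f : X → U → X) (ξₑ : X) : Prop :=
  ∃ (β : ℝ → ℝ → ℝ) (χ : ℝ → ℝ), IsClassKL β ∧ IsClassK χ ∧
    ∀ (ξ₀ : X) (u : ℝ → U), IsInput u →
      (∃ ξ, IsSolution f u ξ₀ ξ) ∧
      ∀ ξ, IsSolution f u ξ₀ ξ → inputNorm u < ⊤ → ∀ t, 0 ≤ t →
        ‖ξ t - ξₑ‖ ≤ max (β ‖ξ₀ - ξₑ‖ t) (χ (inputNorm u).toReal)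

end Systems

/-! ### Singularly perturbed systems -/

/-- Standing regularity of the dynamics: locally Lipschitz in the state `(a, b)`, locally
uniformly in the input, and measurable and locally bounded in the input. This is implied both by
local Lipschitz continuity in all the variables and by piecewise continuity in the input. -/
structure IsRegularDynamics {k l i j : ℕ} (g : Euc k → Euc l → Euc i → Euc j) : Prop where
  lipschitz : ∀ R : ℝ, ∃ L : ℝ, ∀ (a a' : Euc k) (b b' : Euc l) (u : Euc i),
    ‖a‖ ≤ R → ‖a'‖ ≤ R → ‖b‖ ≤ R → ‖b'‖ ≤ R → ‖u‖ ≤ R →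
      ‖g a b u - g a' b' u‖ ≤ L * (‖a - a'‖ + ‖b - b'‖)
  measurable_input : ∀ (a : Euc k) (b : Euc l), Measurable (g a b)
  bounded_input : ∀ (a : Euc k) (b : Euc l) (R : ℝ), ∃ M : ℝ, ∀ u : Euc i,
    ‖u‖ ≤ R → ‖g a b u‖ ≤ M

/-- The pair `(a, b)` as a vector with the Euclidean norm `(|a|² + |b|²)^(1/2)`. -/
abbrev pair {k l : ℕ} (a : Euc k) (b : Euc l) : WithLp 2 (Euc k × Euc l) :=
  WithLp.toLp 2 (a, b)

/-- The right-hand side of `x' = ρs(x,z,d) gs(x,z,d)`, `z' = ρf(z,x,w) gf(z,x,w)`,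
with state `(x, z)` and input `(d, w)`. -/
noncomputable def perturbedSystem {n m p q : ℕ}
    (ρs : Euc n → Euc m → Euc p → ℝ) (ρf : Euc m → Euc n → Euc q → ℝ)
    (gs : Euc n → Euc m → Euc p → Euc n) (gf : Euc m → Euc n → Euc q → Euc m)
    (ξ : WithLp 2 (Euc n × Euc m)) (u : WithLp 2 (Euc p × Euc q)) :
    WithLp 2 (Euc n × Euc m) :=
  pair (ρs ξ.fst ξ.snd u.fst • gs ξ.fst ξ.snd u.fst)
    (ρf ξ.snd ξ.fst u.snd • gf ξ.snd ξ.fst u.snd)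

/-- `φ` is a locally Lipschitz steady-state map. -/
structure IsSteadyStateMap {n m p q : ℕ} (gs : Euc n → Euc m → Euc p → Euc n)
    (gf : Euc m → Euc n → Euc q → Euc m) (φ : Euc n → Euc m) : Prop where
  locallyLipschitz : LocallyLipschitz φ
  slow_eq_zero : gs 0 (φ 0) 0 = 0
  fast_eq_zero : ∀ x, gf (φ x) x 0 = 0

/-- Lyapunov characterization of the stability of the reduced-order subsystem `x' = gs(x,z,d)`. -/
structure IsSlowLyapunov {n m p : ℕ} (gs : Euc n → Euc m → Euc p → Euc n)
    (Vs : Euc n → ℝ) (Vf : Euc m → Euc n → ℝ)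
    (αlow αup γs χs αs : ℝ → ℝ) : Prop where
  contDiff : ContDiff ℝ 1 Vs
  low : IsClassKInf αlow
  up : IsClassKInf αup
  gain : IsClassKInf γs
  inputGain : IsClassKInf χs
  rate : IsClassPD αs
  bounds : ∀ x, αlow ‖x‖ ≤ Vs x ∧ Vs x ≤ αup ‖x‖
  decay : ∀ x z d, max (γs (Vf z x)) (χs ‖d‖) ≤ Vs x →
    fderiv ℝ Vs x (gs x z d) ≤ -αs (Vs x)

/-- Lyapunov characterization of the stability of the boundary-layer subsystem `z' = gf(z,x,w)`. -/
structure IsFastLyapunov {n m q : ℕ} (gf : Euc m → Euc n → Euc q → Euc m)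
    (φ : Euc n → Euc m) (Vs : Euc n → ℝ) (Vf : Euc m → Euc n → ℝ)
    (αlow αup χf αf l₁ l₂ : ℝ → ℝ) : Prop where
  contDiff : ContDiff ℝ 1 (Function.uncurry Vf)
  low : IsClassKInf αlow
  up : IsClassKInf αup
  inputGain : IsClassKInf χf
  rate : IsClassPD αf
  pd₁ : IsClassPD l₁
  pd₂ : IsClassPD l₂
  bounds : ∀ z x, αlow ‖z - φ x‖ ≤ Vf z x ∧ Vf z x ≤ αup ‖z - φ x‖
  decay : ∀ z x w, χf ‖w‖ ≤ Vf z x →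
    fderiv ℝ (fun z' => Vf z' x) z (gf z x w) ≤ -αf (Vf z x)
  growth : ∀ z x, ‖fderiv ℝ (fun x' => Vf z x') x‖ ≤ l₁ (Vf z x) + l₂ (Vs x)

/-- The growth bound `r ↦ G (αs⁻¹(γs r) + αf⁻¹ r + γs (χs⁻¹ r))`, where `αs`, `αf` are the lower
bounds of the slow and of the fast Lyapunov function. -/
noncomputable def gBar (G αs αf γs χs : ℝ → ℝ) (r : ℝ) : ℝ :=
  G (kInv αs (γs r) + kInv αf r + γs (kInv χs r))

/-- The gradient bound `r ↦ l₁ r + l₂ (γs r)`. -/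
def lambdaBar (l₁ l₂ γs : ℝ → ℝ) (r : ℝ) : ℝ :=
  l₁ r + l₂ (γs r)

/-! ### Comparison functions -/

/-! The proof follows the single quantity `v = max (Vs, γs (Vf))`. Where `Vs` dominates and exceeds
a level fixed by the inputs, the slow Lyapunov condition applies directly. Where `γs (Vf)`
dominates, the derivative of `Vf` is at most `-cf αf(Vf)` plus the drift `cs |gs| (l₁(Vf) + l₂(Vs))`
caused by the motion of `x`. Substituting `Vs ≤ γs (Vf)` turns the drift bound into `cs ḡs λ̄f`, and
the condition on `c₀ = cs / cf` says exactly that `αf` wins. These are `slow_decay`, `fast_decay`,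
`coupledFastRate_pos` and `coupledFastRate_anti`.

Since `γs` is only continuous, `v` need not be differentiable, even between switches. The decay is
therefore measured in time scales, the primitives `F` and `J` of the reciprocals of the two decay
rates: `F (Vs)`, respectively `J (Vf)`, falls at unit rate in its own regime. In the combined scale
`H = F + J ∘ γs⁻¹` one summand of `H (v)` falls at unit rate while the other cannot rise, whichever
function dominates. Hence `H (v t) ≤ H (v 0) - t` as long as `v` exceeds the level
(`CoupledDecrease.scale_le`). The slow rate is capped by the identity, so `H` grows at least like
the logarithm at both ends and maps `(0, ∞)` onto `ℝ`; then `H⁻¹ (H r - t)` is a `KL` bound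
(`exists_isClassKL_of_le_sub`). The bounds on `Vs` and `Vf` and the continuity of `φ` convert it
into a bound on the state (`exists_estimate_of_isSolutionOn`).

This estimate holds on every finite horizon on which a solution exists, so it is also an a priori
bound. A cut-off right-hand side has global solutions by Picard iteration, and a first-exit argument
shows that the cutoff is never felt (`exists_isSolution_of_norm_le`). -/

namespace IsClassK

variable {α α' : ℝ → ℝ}

theorem monotoneOn (h : IsClassK α) : MonotoneOn α (Ici 0) := h.strictMonoOn.monotoneOn

theorem nonneg (h : IsClassK α) {r : ℝ} (hr : 0 ≤ r) : 0 ≤ α r := by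
  have := h.monotoneOn (self_mem_Ici (a := (0 : ℝ))) hr hr
  rwa [h.map_zero] at this

theorem pos (h : IsClassK α) {r : ℝ} (hr : 0 < r) : 0 < α r := by
  have := h.strictMonoOn (self_mem_Ici (a := (0 : ℝ))) hr.le hr
  rwa [h.map_zero] at this

theorem mapsTo (h : IsClassK α) : MapsTo α (Ici 0) (Ici 0) := fun _ hr => h.nonneg hr

theorem mono (h : IsClassK α) {r s : ℝ} (hr : 0 ≤ r) (hrs : r ≤ s) : α r ≤ α s :=
  h.monotoneOn hr (hr.trans hrs : (0 : ℝ) ≤ s) hrs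

theorem le_iff_le (h : IsClassK α) {r s : ℝ} (hr : 0 ≤ r) (hs : 0 ≤ s) : α r ≤ α s ↔ r ≤ s :=
  h.strictMonoOn.le_iff_le hr hs

theorem lt_iff_lt (h : IsClassK α) {r s : ℝ} (hr : 0 ≤ r) (hs : 0 ≤ s) : α r < α s ↔ r < s :=
  h.strictMonoOn.lt_iff_lt hr hs

theorem continuousOn_comp {Y : Type*} [TopologicalSpace Y] {f : Y → ℝ} {s : Set Y}
    (h : IsClassK α) (hf : ContinuousOn f s) (h0 : ∀ y ∈ s, 0 ≤ f y) :
    ContinuousOn (fun y => α (f y)) s :=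
  h.continuousOn.comp hf h0

theorem comp (h : IsClassK α) (h' : IsClassK α') : IsClassK fun r => α (α' r) where
  continuousOn := h.continuousOn_comp h'.continuousOn fun _ hr => h'.nonneg hr
  map_zero := by rw [h'.map_zero, h.map_zero]
  strictMonoOn := h.strictMonoOn.comp h'.strictMonoOn h'.mapsTo

theorem max (h : IsClassK α) (h' : IsClassK α') : IsClassK fun r => Max.max (α r) (α' r) where
  continuousOn := h.continuousOn.sup h'.continuousOn
  map_zero := by rw [h'.map_zero, h.map_zero, max_self]
  strictMonoOn := fun _ hr _ hs hrs =>
    max_lt_max (h.strictMonoOn hr hs hrs) (h'.strictMonoOn hr hs hrs)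

theorem add_monotoneOn (h : IsClassK α) (hc : ContinuousOn α' (Ici 0)) (h0 : α' 0 = 0)
    (hm : MonotoneOn α' (Ici 0)) : IsClassK fun r => α r + α' r where
  continuousOn := h.continuousOn.add hc
  map_zero := by rw [h0, h.map_zero, add_zero]
  strictMonoOn := fun _ hr _ hs hrs =>
    add_lt_add_of_lt_of_le (h.strictMonoOn hr hs hrs) (hm hr hs hrs.le)

theorem add (h : IsClassK α) (h' : IsClassK α') : IsClassK fun r => α r + α' r :=
  h.add_monotoneOn h'.continuousOn h'.map_zero h'.monotoneOn

end IsClassK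

theorem isClassK_id : IsClassK fun r => r where
  continuousOn := continuousOn_id
  map_zero := rfl
  strictMonoOn := strictMono_id.strictMonoOn _

namespace IsClassPD

variable {α : ℝ → ℝ}

theorem nonneg (h : IsClassPD α) {r : ℝ} (hr : 0 ≤ r) : 0 ≤ α r := by
  rcases hr.eq_or_lt with rfl | hr
  · exact h.map_zero.ge
  · exact (h.pos r hr).le

theorem continuousOn_comp {Y : Type*} [TopologicalSpace Y] {f : Y → ℝ} {s : Set Y}
    (h : IsClassPD α) (hf : ContinuousOn f s) (h0 : ∀ y ∈ s, 0 ≤ f y) :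
    ContinuousOn (fun y => α (f y)) s :=
  h.continuousOn.comp hf h0

end IsClassPD

namespace IsClassKInf

variable {α : ℝ → ℝ}

theorem kInv_nonneg (h : IsClassKInf α) {r : ℝ} (hr : 0 ≤ r) : 0 ≤ kInv α r :=
  h.bijOn.surjOn.mapsTo_invFunOn hr

theorem apply_kInv (h : IsClassKInf α) {r : ℝ} (hr : 0 ≤ r) : α (kInv α r) = r :=
  h.invOn_kInv.2 hr

theorem kInv_apply (h : IsClassKInf α) {r : ℝ} (hr : 0 ≤ r) : kInv α (α r) = r :=
  h.invOn_kInv.1 hr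

theorem le_kInv_iff (h : IsClassKInf α) {r s : ℝ} (hr : 0 ≤ r) (hs : 0 ≤ s) :
    r ≤ kInv α s ↔ α r ≤ s := by
  rw [← h.toIsClassK.le_iff_le hr (h.kInv_nonneg hs), h.apply_kInv hs]

theorem lt_kInv_iff (h : IsClassKInf α) {r s : ℝ} (hr : 0 ≤ r) (hs : 0 ≤ s) :
    r < kInv α s ↔ α r < s := by
  rw [← h.toIsClassK.lt_iff_lt hr (h.kInv_nonneg hs), h.apply_kInv hs]

theorem kInv_le_iff (h : IsClassKInf α) {r s : ℝ} (hr : 0 ≤ r) (hs : 0 ≤ s) :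
    kInv α s ≤ r ↔ s ≤ α r := by
  rw [← h.toIsClassK.le_iff_le (h.kInv_nonneg hs) hr, h.apply_kInv hs]

/-- The inverse of a function of class `K∞` is of class `K`. -/
theorem isClassK_kInv (h : IsClassKInf α) : IsClassK (kInv α) where
  continuousOn := by
    -- Continuity of the inverse is free for order isomorphisms, which are homeomorphisms in the
    -- order topology.
    let e : Ici (0 : ℝ) ≃o Ici (0 : ℝ) :=
      StrictMono.orderIsoOfSurjective (h.bijOn.mapsTo.restrict α (Ici 0) (Ici 0))
        (fun r s hrs => h.strictMonoOn r.2 s.2 hrs) (h.bijOn.mapsTo.restrict_surjective_iff.2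
          h.bijOn.surjOn)
    rw [continuousOn_iff_continuous_domRestrict]
    have : (Ici (0 : ℝ)).domRestrict (kInv α) = fun r => (e.symm r : ℝ) := by
      ext r
      have h1 : α (e.symm r : ℝ) = r := congrArg Subtype.val (e.apply_symm_apply r)
      rw [domRestrict_apply, ← h1, h.kInv_apply (e.symm r).2]
    rw [this]
    exact continuous_subtype_val.comp e.symm.continuous
  map_zero := by
    have := h.kInv_apply le_rfl
    rwa [h.map_zero] at this
  strictMonoOn := fun r hr s hs hrs => by
    rwa [h.lt_kInv_iff (h.kInv_nonneg hr) hs, h.apply_kInv hr]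

end IsClassKInf

/-- A continuous map is bounded, relative to its value at zero, by a function of class `K`. -/
theorem exists_isClassK_norm_sub_le {X Y : Type*} [NormedAddCommGroup X] [NormedSpace ℝ X]
    [ProperSpace X] [NormedAddCommGroup Y] {φ : X → Y} (hφ : Continuous φ) :
    ∃ ω, IsClassK ω ∧ ∀ x, ‖φ x - φ 0‖ ≤ ω ‖x‖ := by
  let B : Set X := Metric.closedBall 0 1
  have hB : IsCompact B := isCompact_closedBall 0 1
  -- Rescaling to the unit ball keeps the compact set fixed, so that the supremum depends
  -- continuously on the radius `r`.
  let f : ℝ → X → ℝ := fun r y => ‖φ (r • y) - φ 0‖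
  have hf : Continuous ↿f := by
    change Continuous fun p : ℝ × X => ‖φ (p.1 • p.2) - φ 0‖
    fun_prop
  let S : ℝ → ℝ := fun r => sSup (f r '' B)
  have hS : Continuous S := hB.continuous_sSup hf
  have hfr (r : ℝ) : Continuous (f r) := hf.comp (Continuous.prodMk_right r)
  have hbdd (r : ℝ) : BddAbove (f r '' B) := (hB.image (hfr r)).bddAbove
  have hle {r : ℝ} {x : X} (hx : ‖x‖ ≤ r) : ‖φ x - φ 0‖ ≤ S r := by
    rcases (norm_nonneg x).trans hx |>.eq_or_lt with h0 | h0
    · have hx0 : x = 0 := by simpa [← h0] using hx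
      refine le_csSup (hbdd r) ⟨0, by simp [B], by simp [f, hx0]⟩
    · refine le_csSup (hbdd r) ⟨r⁻¹ • x, ?_, ?_⟩
      · rw [mem_closedBall_zero_iff, norm_smul, norm_inv, Real.norm_of_nonneg h0.le,
          inv_mul_le_iff₀ h0, mul_one]
        exact hx
      · simp [f, smul_smul, h0.ne']
  -- `S` is only nondecreasing; the added identity makes the bound strictly increasing.
  refine ⟨fun r => r + S r, isClassK_id.add_monotoneOn hS.continuousOn ?_ ?_, fun x => ?_⟩
  · have : f 0 '' B = {0} := by
      ext c
      simp only [f, zero_smul, sub_self, norm_zero, mem_image, mem_singleton_iff]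
      exact ⟨fun ⟨_, _, h⟩ => h.symm, fun h => ⟨0, by simp [B], h.symm⟩⟩
    simp [S, this]
  · intro r hr s hs hrs
    refine csSup_le ((Metric.nonempty_closedBall.2 zero_le_one).image _) ?_
    rintro _ ⟨y, hy, rfl⟩
    refine hle ?_
    rw [norm_smul, Real.norm_of_nonneg hr]
    calc r * ‖y‖ ≤ r * 1 := mul_le_mul_of_nonneg_left (mem_closedBall_zero_iff.1 hy) hr
      _ ≤ s := by rwa [mul_one]
  · have := hle (le_refl ‖x‖)
    linarith [norm_nonneg x]

/-- Composing a function of class `KL` with functions of class `K` on both sides. -/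
theorem IsClassKL.comp {β : ℝ → ℝ → ℝ} {Ψ Φ : ℝ → ℝ} (h : IsClassKL β) (hΨ : IsClassK Ψ)
    (hΦ : IsClassK Φ) : IsClassKL fun s t => Ψ (β (Φ s) t) where
  continuousOn := by
    refine hΨ.continuousOn_comp (f := fun p : ℝ × ℝ => β (Φ p.1) p.2) ?_
      fun p hp => (h.classK p.2 hp.2).nonneg (hΦ.nonneg hp.1)
    refine h.continuousOn.comp (f := fun p : ℝ × ℝ => (Φ p.1, p.2)) ?_
      fun p hp => ⟨hΦ.nonneg hp.1, hp.2⟩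
    exact (hΦ.continuousOn_comp continuousOn_fst fun p hp => hp.1).prodMk continuousOn_snd
  classK := fun t ht => hΨ.comp ((h.classK t ht).comp hΦ)
  antitoneOn := fun s hs t ht t' ht' htt' =>
    hΨ.mono ((h.classK t' ht').nonneg (hΦ.nonneg hs.le)) (h.antitoneOn _ (hΦ.pos hs) ht ht' htt')
  tendsto_zero := fun s hs => by
    have h0 : Tendsto (β (Φ s)) atTop (𝓝[Ici 0] 0) :=
      tendsto_nhdsWithin_iff.2 ⟨h.tendsto_zero _ (hΦ.pos hs), by
        filter_upwards [eventually_ge_atTop 0] with t ht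
        exact (h.classK t ht).nonneg (hΦ.nonneg hs.le)⟩
    have h1 : Tendsto Ψ (𝓝[Ici 0] 0) (𝓝 (Ψ 0)) := hΨ.continuousOn 0 self_mem_Ici
    rw [hΨ.map_zero] at h1
    exact h1.comp h0

/-- The `KL` function describing the flow that decreases `H` at unit rate. -/
theorem exists_isClassKL_of_le_sub {H : ℝ → ℝ} (hc : ContinuousOn H (Ioi 0))
    (hm : StrictMonoOn H (Ioi 0)) (hlo : ∀ r, 0 < r → r ≤ 1 → H r ≤ Real.log r)
    (hhi : ∀ r, 1 ≤ r → Real.log r ≤ H r) :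
    ∃ β, IsClassKL β ∧ ∀ r y t, 0 < r → 0 < y → H y ≤ H r - t → y ≤ β r t := by
  -- In the logarithmic variable, `H` becomes an increasing bijection of `ℝ`; the comparison with
  -- `log` supplies both infinite limits.
  have hcont : Continuous fun s => H (Real.exp s) :=
    hc.comp_continuous Real.continuous_exp Real.exp_pos
  have hsurj : Function.Surjective fun s => H (Real.exp s) := by
    refine hcont.surjective (tendsto_atTop_mono' _ ?_ tendsto_id) (tendsto_atBot_mono' _ ?_ tendsto_id)
    · filter_upwards [eventually_ge_atTop 0] with s hs
      simpa using hhi (Real.exp s) (Real.one_le_exp hs)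
    · filter_upwards [eventually_le_atBot 0] with s hs
      simpa using hlo (Real.exp s) (Real.exp_pos s) (Real.exp_le_one_iff.2 hs)
  let e : ℝ ≃o ℝ := StrictMono.orderIsoOfSurjective (fun s => H (Real.exp s))
    (fun s s' h => hm (Real.exp_pos s) (Real.exp_pos s') (Real.exp_lt_exp.2 h)) hsurj
  have he (s : ℝ) : e s = H (Real.exp s) := rfl
  -- This is `H⁻¹ (H r - t)` for `r > 0`. The value `0` at `r = 0` is the continuous extension,
  -- because `0 ≤ β r t ≤ r`.
  let β : ℝ → ℝ → ℝ := fun r t => if r ≤ 0 then 0 else Real.exp (e.symm (e (Real.log r) - t))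
  have hβ0 (t : ℝ) : β 0 t = 0 := if_pos le_rfl
  have hβ {r : ℝ} (hr : 0 < r) (t : ℝ) : β r t = Real.exp (e.symm (e (Real.log r) - t)) :=
    if_neg hr.not_ge
  have hnn (r t : ℝ) : 0 ≤ β r t := by
    simp only [β]; split_ifs
    exacts [le_rfl, (Real.exp_pos _).le]
  have hle {r t : ℝ} (hr : 0 ≤ r) (ht : 0 ≤ t) : β r t ≤ r := by
    rcases hr.eq_or_lt with rfl | hr
    · exact (hβ0 t).le
    · rw [hβ hr, ← Real.le_log_iff_exp_le hr, e.symm_apply_le]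
      linarith
  have hmono {t : ℝ} : StrictMonoOn (fun r => β r t) (Ici 0) := by
    intro r hr s hs hrs
    have hs0 : 0 < s := lt_of_le_of_lt hr hrs
    change β r t < β s t
    rcases (mem_Ici.1 hr).eq_or_lt with rfl | hr
    · rw [hβ0, hβ hs0]; exact Real.exp_pos _
    · rw [hβ hr, hβ hs0, Real.exp_lt_exp, e.symm.lt_iff_lt, sub_lt_sub_iff_right, e.lt_iff_lt]
      exact Real.log_lt_log hr hrs
  have hcontβ : ContinuousOn (Function.uncurry β) (Ici 0 ×ˢ Ici 0) := by
    rintro ⟨r, t⟩ ⟨hr, ht⟩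
    rcases (mem_Ici.1 hr).eq_or_lt with rfl | hr
    · have h0 : Function.uncurry β (0, t) = 0 := hβ0 t
      rw [ContinuousWithinAt, h0]
      refine squeeze_zero' (g := fun p : ℝ × ℝ => p.1) (Eventually.of_forall fun p => hnn p.1 p.2)
        ?_ ?_
      · filter_upwards [self_mem_nhdsWithin] with p hp using hle hp.1 hp.2
      · exact (continuous_fst.tendsto' (0, t) 0 rfl).mono_left nhdsWithin_le_nhds
    · refine ContinuousAt.continuousWithinAt ?_
      have : ContinuousAt (fun p : ℝ × ℝ => Real.exp (e.symm (e (Real.log p.1) - p.2))) (r, t) := by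
        have hlog : ContinuousAt (fun p : ℝ × ℝ => Real.log p.1) (r, t) :=
          continuousAt_fst.log hr.ne'
        have h2 : ContinuousAt (fun p : ℝ × ℝ => e (Real.log p.1) - p.2) (r, t) :=
          (e.continuous.continuousAt.comp hlog).sub continuousAt_snd
        exact Real.continuous_exp.continuousAt.comp (e.symm.continuous.continuousAt.comp h2)
      refine this.congr ?_
      filter_upwards [(isOpen_lt continuous_const continuous_fst).mem_nhds
        (show (r, t) ∈ {p : ℝ × ℝ | 0 < p.1} from hr)] with p hp
      exact (hβ hp p.2).symm
  refine ⟨β, ⟨hcontβ, fun t ht => ⟨?_, hβ0 t, hmono⟩, ?_, ?_⟩, ?_⟩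
  · exact hcontβ.comp (f := fun s => (s, t)) (by fun_prop) fun s hs => ⟨hs, ht⟩
  · intro s hs t _ t' _ htt'
    rw [hβ hs, hβ hs, Real.exp_le_exp, e.symm.le_iff_le]
    linarith
  · intro s hs
    have h1 : Tendsto (fun t => e (Real.log s) - t) atTop atBot :=
      tendsto_atBot_add_const_left _ _ tendsto_neg_atTop_atBot
    have h2 := Real.tendsto_exp_atBot.comp (e.symm.tendsto_atBot.comp h1)
    exact h2.congr fun t => (hβ hs t).symm
  · intro r y t hr hy h
    rw [hβ hr, ← Real.log_le_iff_le_exp hy, e.le_symm_apply, he, he, Real.exp_log hy,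
      Real.exp_log hr]
    exact h

/-! ### Decrease along absolutely continuous curves -/

theorem norm_sub_le_of_eq_integral {E : Type*} [NormedAddCommGroup E] [NormedSpace ℝ E]
    {ξ g : ℝ → E} {a b M : ℝ} (hg : IntervalIntegrable g volume a b)
    (hξ : ∀ t ∈ Icc a b, ξ t = ξ a + ∫ s in a..t, g s)
    (hM : ∀ᵐ s, s ∈ Icc a b → ‖g s‖ ≤ M) {t s : ℝ} (ht : t ∈ Icc a b) (hs : s ∈ Icc a b)
    (hts : t ≤ s) : ξ s - ξ t = (∫ τ in t..s, g τ) ∧ ‖ξ s - ξ t‖ ≤ M * (s - t) := by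
  have hi {c d : ℝ} (hc : c ∈ Icc a b) (hd : d ∈ Icc a b) : IntervalIntegrable g volume c d :=
    hg.mono_set (uIcc_subset_uIcc (Icc_subset_uIcc hc) (Icc_subset_uIcc hd))
  have ha : a ∈ Icc a b := ⟨le_rfl, ht.1.trans ht.2⟩
  have h1 : ξ s - ξ t = ∫ τ in t..s, g τ := by
    rw [hξ s hs, hξ t ht, ← intervalIntegral.integral_add_adjacent_intervals (hi ha ht) (hi ht hs)]
    abel
  refine ⟨h1, ?_⟩
  rw [h1]
  have := intervalIntegral.norm_integral_le_of_norm_le_const_ae (a := t) (b := s) (f := g) (C := M) ?_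
  · rwa [abs_of_nonneg (sub_nonneg.2 hts)] at this
  · filter_upwards [hM] with τ hτ hτ'
    rw [uIoc_of_le hts] at hτ'
    exact hτ ⟨ht.1.trans hτ'.1.le, hτ'.2.trans hs.2⟩

theorem continuousOn_of_eq_integral {E : Type*} [NormedAddCommGroup E] [NormedSpace ℝ E]
    {ξ g : ℝ → E} {a b : ℝ} (hab : a ≤ b) (hg : IntervalIntegrable g volume a b)
    (hξ : ∀ t ∈ Icc a b, ξ t = ξ a + ∫ s in a..t, g s) : ContinuousOn ξ (Icc a b) := by
  have := intervalIntegral.continuousOn_primitive_interval' hg left_mem_uIcc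
  rw [uIcc_of_le hab] at this
  exact (continuousOn_const.add this).congr hξ

/-- A function whose derivative along the velocity of a Lipschitz curve is at most `-1` almost
everywhere decreases at unit rate along the curve. -/
theorem le_sub_of_fderiv_apply_le_neg_one {E : Type*} [NormedAddCommGroup E] [NormedSpace ℝ E]
    [CompleteSpace E] {W : E → ℝ} {W' : E → E →L[ℝ] ℝ} {ξ g : ℝ → E} {a b M : ℝ} (hab : a ≤ b)
    (hg : IntervalIntegrable g volume a b) (hξ : ∀ t ∈ Icc a b, ξ t = ξ a + ∫ s in a..t, g s)
    (hM : ∀ᵐ s, s ∈ Icc a b → ‖g s‖ ≤ M) (hW : ∀ t ∈ Icc a b, HasFDerivAt W (W' (ξ t)) (ξ t))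
    (hW' : ContinuousOn (fun t => W' (ξ t)) (Icc a b))
    (hdec : ∀ᵐ s, s ∈ Icc a b → W' (ξ s) (g s) ≤ -1) : W (ξ b) ≤ W (ξ a) - (b - a) := by
  wlog hM0 : 0 ≤ M generalizing M
  · refine this (M := max M 0) ?_ (le_max_right _ _)
    filter_upwards [hM] with s hs hs' using (hs hs').trans (le_max_left _ _)
  have hc : ContinuousOn ξ (Icc a b) := continuousOn_of_eq_integral hab hg hξ
  have hWc : ContinuousOn (fun t => W (ξ t)) (Icc a b) := fun t ht =>
    (hW t ht).continuousAt.comp_continuousWithinAt (hc t ht)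
  -- A bound on right slopes suffices, so no almost-everywhere chain rule for the absolutely
  -- continuous curve is needed.
  refine image_le_of_liminf_slope_right_le_deriv_boundary (f := fun t => W (ξ t))
    (B := fun t => W (ξ a) - (t - a)) (B' := fun _ => -1) hWc (by simp) (by fun_prop)
    (fun t _ => ?_) (fun t ht r hr => ?_) (right_mem_Icc.2 hab)
  · exact (((hasDerivAt_id t).sub_const a).const_sub (W (ξ a))).hasDerivWithinAt
  · have ht' : t ∈ Icc a b := Ico_subset_Icc_self ht
    -- Two errors of size `ε * M` arise per unit of time: one from freezing `W'` at time `t`, one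
    -- from the differentiability remainder of `W`.
    obtain ⟨ε, hε, hεr⟩ : ∃ ε > 0, -1 + ε * (2 * M) < r := by
      refine ⟨(r + 1) / (2 * M + 1), div_pos (by linarith) (by linarith), ?_⟩
      have : (r + 1) / (2 * M + 1) * (2 * M) < r + 1 := by
        rw [div_mul_eq_mul_div, div_lt_iff₀ (by linarith)]
        nlinarith
      linarith
    obtain ⟨δ₁, hδ₁, h1⟩ := Metric.continuousOn_iff.1 hW' t ht' ε hε
    have h2 := (hW t ht').isLittleO.def hε
    obtain ⟨η, hη, h2⟩ := Metric.eventually_nhds_iff.1 h2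
    obtain ⟨δ₂, hδ₂, h3⟩ := Metric.continuousOn_iff.1 hc t ht' η hη
    have hmem : Ioo t (min b (t + min δ₁ δ₂)) ∈ 𝓝[>] t :=
      Ioo_mem_nhdsGT (lt_min ht.2 (by linarith [lt_min hδ₁ hδ₂]))
    refine (eventually_of_mem hmem fun s hs => ?_).frequently
    have hsb : s < b := hs.2.trans_le (min_le_left _ _)
    have hsd : s < t + min δ₁ δ₂ := hs.2.trans_le (min_le_right _ _)
    have hs' : s ∈ Icc a b := ⟨ht.1.trans hs.1.le, hsb.le⟩
    have hst : 0 < s - t := sub_pos.2 hs.1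
    obtain ⟨h4, h5⟩ := norm_sub_le_of_eq_integral hg hξ hM ht' hs' hs.1.le
    have h6 : W' (ξ t) (ξ s - ξ t) ≤ (-1 + ε * M) * (s - t) := by
      have hi : IntervalIntegrable g volume t s :=
        hg.mono_set (uIcc_subset_uIcc (Icc_subset_uIcc ht') (Icc_subset_uIcc hs'))
      rw [h4, ← (W' (ξ t)).intervalIntegral_comp_comm hi]
      have : ∫ τ in t..s, W' (ξ t) (g τ) ≤ ∫ τ in t..s, (-1 + ε * M) := by
        refine intervalIntegral.integral_mono_ae_restrict hs.1.le
          ((W' (ξ t)).integrable_comp hi.1 |> fun h => ⟨h, (W' (ξ t)).integrable_comp hi.2⟩)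
          intervalIntegrable_const ?_
        rw [EventuallyLE, ae_restrict_iff' measurableSet_Icc]
        filter_upwards [hM, hdec] with τ hτM hτd hτ
        have hτ' : τ ∈ Icc a b := ⟨ht.1.trans hτ.1, hτ.2.trans hs'.2⟩
        have hd : dist (W' (ξ τ)) (W' (ξ t)) < ε := by
          refine h1 τ hτ' ?_
          rw [Real.dist_eq, abs_of_nonneg (sub_nonneg.2 hτ.1)]
          linarith [hτ.2, min_le_left δ₁ δ₂]
        rw [dist_eq_norm'] at hd
        have h7 := ((W' (ξ t) - W' (ξ τ)).le_opNorm (g τ)).trans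
          (mul_le_mul hd.le (hτM hτ') (norm_nonneg _) hε.le)
        have h8 := (le_abs_self _).trans h7
        simp only [sub_apply] at h8
        linarith [hτd hτ']
      rwa [intervalIntegral.integral_const, smul_eq_mul, mul_comm] at this
    have h9 : dist (ξ s) (ξ t) < η := by
      refine h3 s hs' ?_
      rw [Real.dist_eq, abs_of_nonneg hst.le]
      linarith [min_le_right δ₁ δ₂]
    have h10 := (le_abs_self _).trans (h2 h9)
    have h11 : ε * ‖ξ s - ξ t‖ ≤ ε * (M * (s - t)) := mul_le_mul_of_nonneg_left h5 hε.le
    rw [slope_def_field, div_lt_iff₀ hst]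
    have h12 : (-1 + ε * (2 * M)) * (s - t) < r * (s - t) := mul_lt_mul_of_pos_right hεr hst
    nlinarith

/-! ### Time scales of scalar decay rates -/

/-- The time that `r' = -α r` needs from `r₀` to `r`, up to sign. -/
theorem exists_hasDerivAt_inv {α : ℝ → ℝ} (hc : ContinuousOn α (Ioi 0)) (hp : ∀ r, 0 < r → 0 < α r)
    {r₀ : ℝ} (hr₀ : 0 < r₀) :
    ∃ F : ℝ → ℝ, F r₀ = 0 ∧ StrictMonoOn F (Ioi 0) ∧ ∀ r, 0 < r → HasDerivAt F (α r)⁻¹ r := by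
  have hci : ContinuousOn (fun r => (α r)⁻¹) (Ioi 0) := hc.inv₀ fun r hr => (hp r hr).ne'
  have hd : ∀ r, 0 < r → HasDerivAt (fun r => ∫ ρ in r₀..r, (α ρ)⁻¹) (α r)⁻¹ r := by
    intro r hr
    refine intervalIntegral.integral_hasDerivAt_right ?_ ?_ ?_
    · exact (hci.mono ((ordConnected_Ioi (a := (0 : ℝ))).uIcc_subset hr₀ hr)).intervalIntegrable
    · exact hci.stronglyMeasurableAtFilter isOpen_Ioi r hr
    · exact hci.continuousAt (Ioi_mem_nhds hr)
  refine ⟨_, intervalIntegral.integral_same, ?_, hd⟩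
  refine strictMonoOn_of_deriv_pos (convex_Ioi 0)
    (fun r hr => (hd r hr).continuousAt.continuousWithinAt) fun r hr => ?_
  rw [interior_Ioi] at hr
  rw [(hd r hr).deriv]
  exact inv_pos.2 (hp r hr)

/-- Since `1 / α ≥ 1 / r`, the scale `F` is at least as steep as the logarithm. This is why the slow
decay rate is capped by the identity: it makes the combined time scale unbounded in both directions.
-/
theorem monotoneOn_sub_log {α F : ℝ → ℝ} (hp : ∀ r, 0 < r → 0 < α r) (hle : ∀ r, 0 < r → α r ≤ r)
    (hF : ∀ r, 0 < r → HasDerivAt F (α r)⁻¹ r) :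
    MonotoneOn (fun r => F r - Real.log r) (Ioi 0) := by
  have hd (r : ℝ) (hr : 0 < r) : HasDerivAt (fun r => F r - Real.log r) ((α r)⁻¹ - r⁻¹) r :=
    (hF r hr).sub (Real.hasDerivAt_log hr.ne')
  refine monotoneOn_of_deriv_nonneg (convex_Ioi 0)
    (fun r hr => (hd r hr).continuousAt.continuousWithinAt) ?_ fun r hr => ?_ <;>
    rw [interior_Ioi] at *
  · exact fun r hr => (hd r hr).differentiableAt.differentiableWithinAt
  · rw [(hd r hr).deriv]
    exact sub_nonneg.2 (inv_anti₀ (hp r hr) (hle r hr))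

/-- Decrease of a scalar function along a curve, in the time scale of its decay rate. -/
theorem timeScale_le_sub {E : Type*} [NormedAddCommGroup E] [NormedSpace ℝ E]
    [CompleteSpace E] {V : E → ℝ} (hV : ContDiff ℝ 1 V) {α F : ℝ → ℝ}
    (hc : ContinuousOn α (Ioi 0)) (hp : ∀ r, 0 < r → 0 < α r)
    (hF : ∀ r, 0 < r → HasDerivAt F (α r)⁻¹ r) {ξ g : ℝ → E} {a b M : ℝ} (hab : a ≤ b)
    (hg : IntervalIntegrable g volume a b) (hξ : ∀ t ∈ Icc a b, ξ t = ξ a + ∫ s in a..t, g s)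
    (hM : ∀ᵐ s, s ∈ Icc a b → ‖g s‖ ≤ M) (hpos : ∀ t ∈ Icc a b, 0 < V (ξ t))
    (hdec : ∀ᵐ s, s ∈ Icc a b → fderiv ℝ V (ξ s) (g s) ≤ -α (V (ξ s))) :
    F (V (ξ b)) ≤ F (V (ξ a)) - (b - a) := by
  have hcξ : ContinuousOn ξ (Icc a b) := continuousOn_of_eq_integral hab hg hξ
  refine le_sub_of_fderiv_apply_le_neg_one (W := fun y => F (V y))
    (W' := fun y => (α (V y))⁻¹ • fderiv ℝ V y) hab hg hξ hM (fun t ht => ?_) ?_ ?_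
  · exact (hF _ (hpos t ht)).comp_hasFDerivAt _
      (hV.differentiable one_ne_zero).differentiableAt.hasFDerivAt
  · have h1 : ContinuousOn (fun t => (α (V (ξ t)))⁻¹) (Icc a b) :=
      (hc.comp (hV.continuous.comp_continuousOn hcξ) hpos).inv₀ fun t ht => (hp _ (hpos t ht)).ne'
    exact h1.smul ((hV.continuous_fderiv one_ne_zero).comp_continuousOn hcξ)
  · filter_upwards [hdec] with s hs hs'
    have h0 := hp _ (hpos s hs')
    rw [smul_apply, smul_eq_mul, inv_mul_le_iff₀ h0]
    linarith [hs hs']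

/-! ### Two coupled decreasing quantities -/

/-- The last time before `s` at which a continuous function is nonpositive. -/
theorem exists_last_nonpos {f : ℝ → ℝ} {t s : ℝ} (hts : t ≤ s) (hf : ContinuousOn f (Icc t s))
    (ht : f t ≤ 0) (hs : 0 < f s) :
    ∃ r ∈ Ico t s, f r = 0 ∧ ∀ τ ∈ Ioc r s, 0 < f τ := by
  set S : Set ℝ := Icc t s ∩ f ⁻¹' Iic 0
  have hS : IsClosed S := hf.preimage_isClosed_of_isClosed isClosed_Icc isClosed_Iic
  have hSc : IsCompact S := isCompact_Icc.of_isClosed_subset hS inter_subset_left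
  have hmem : sSup S ∈ S := hSc.sSup_mem ⟨t, ⟨le_rfl, hts⟩, ht⟩
  set r := sSup S
  have hrs : r < s := lt_of_le_of_ne hmem.1.2 fun h => by
    have := hmem.2
    rw [h] at this
    exact hs.not_ge this
  have hafter : ∀ τ ∈ Ioc r s, 0 < f τ := fun τ hτ => by
    by_contra! h
    exact hτ.1.not_ge (le_csSup hSc.bddAbove ⟨⟨hmem.1.1.trans hτ.1.le, hτ.2⟩, h⟩)
  refine ⟨r, ⟨hmem.1.1, hrs⟩, le_antisymm hmem.2 ?_, hafter⟩
  have h1 : ContinuousWithinAt f (Ioc r s) r :=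
    (hf r hmem.1).mono fun τ hτ => ⟨hmem.1.1.trans hτ.1.le, hτ.2⟩
  have : (𝓝[Ioc r s] r).NeBot := by
    rw [nhdsWithin_Ioc_eq_nhdsGT hrs]; infer_instance
  exact ge_of_tendsto h1 (eventually_of_mem self_mem_nhdsWithin fun τ hτ => (hafter τ hτ).le)

/-- The data of a comparison argument for `max (a, γ b)`: above the level `θ`, the quantity `a`
decreases at unit rate in the time scale `F` while it dominates, and `b` decreases at unit rate
in the time scale `J` near every time at which it dominates. -/
structure CoupledDecrease (γ F J a b : ℝ → ℝ) (θ T : ℝ) : Prop where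
  gain : IsClassKInf γ
  strictMonoOn_fst : StrictMonoOn F (Ioi 0)
  strictMonoOn_snd : StrictMonoOn J (Ioi 0)
  continuousOn_scale : ContinuousOn (fun r => F r + J (kInv γ r)) (Ioi 0)
  level_nonneg : 0 ≤ θ
  continuousOn_fst : ContinuousOn a (Icc 0 T)
  continuousOn_snd : ContinuousOn b (Icc 0 T)
  nonneg_snd : ∀ t ∈ Icc 0 T, 0 ≤ b t
  decrease_fst : ∀ t ∈ Icc 0 T, ∀ s ∈ Icc t T, (∀ τ ∈ Icc t s, γ (b τ) ≤ a τ ∧ θ < a τ) →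
    F (a s) ≤ F (a t) - (s - t)
  decrease_snd : ∀ t ∈ Ico 0 T, a t ≤ γ (b t) → θ < γ (b t) →
    ∃ δ > 0, ∀ s ∈ Icc t T, s < t + δ → J (b s) ≤ J (b t) - (s - t)

namespace CoupledDecrease

variable {γ F J a b : ℝ → ℝ} {θ T : ℝ}

theorem continuousOn_gain_snd (h : CoupledDecrease γ F J a b θ T) :
    ContinuousOn (fun t => γ (b t)) (Icc 0 T) :=
  h.gain.toIsClassK.continuousOn_comp h.continuousOn_snd h.nonneg_snd

theorem strictMonoOn_snd_kInv (h : CoupledDecrease γ F J a b θ T) :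
    StrictMonoOn (fun r => J (kInv γ r)) (Ioi 0) := fun _ hr _ hs hrs =>
  h.strictMonoOn_snd (h.gain.isClassK_kInv.pos hr) (h.gain.isClassK_kInv.pos hs)
    (h.gain.isClassK_kInv.strictMonoOn (mem_Ici.2 (le_of_lt hr)) (mem_Ici.2 (le_of_lt hs)) hrs)

/-- While `a` dominates, the combined time scale decreases at unit rate. -/
theorem scale_fst_le (h : CoupledDecrease γ F J a b θ T) {t s : ℝ} (ht : t ∈ Icc 0 T)
    (hs : s ∈ Icc t T) (hdom : ∀ τ ∈ Icc t s, γ (b τ) ≤ a τ ∧ θ < a τ) :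
    F (a s) + J (kInv γ (a s)) ≤ F (a t) + J (kInv γ (a t)) - (s - t) := by
  have h1 := h.decrease_fst t ht s hs hdom
  have hat : 0 < a t := h.level_nonneg.trans_lt (hdom t ⟨le_rfl, hs.1⟩).2
  have has : 0 < a s := h.level_nonneg.trans_lt (hdom s ⟨hs.1, le_rfl⟩).2
  have h2 : a s ≤ a t := (h.strictMonoOn_fst.le_iff_le has hat).1 (by linarith [hs.1])
  have h3 : J (kInv γ (a s)) ≤ J (kInv γ (a t)) := h.strictMonoOn_snd_kInv.monotoneOn has hat h2
  linarith

/-- The local step. Strict dominance of `a` persists for a short time. Otherwise `b` decreases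
throughout a short window, even if `a` overtakes `γ b` inside it; the window is then split at the
last time at which they agree, with the decrease of `b` before and that of `a` after. -/
theorem exists_gt_scale_le (h : CoupledDecrease γ F J a b θ T) {t c : ℝ} (ht : t ∈ Ico 0 T)
    (hθ : θ < max (a t) (γ (b t))) (hc : t < c) :
    ∃ s ∈ Ioc t c, s ≤ T ∧
      F (max (a s) (γ (b s))) + J (kInv γ (max (a s) (γ (b s)))) ≤
        F (max (a t) (γ (b t))) + J (kInv γ (max (a t) (γ (b t)))) - (s - t) := by
  have ht' : t ∈ Icc 0 T := Ico_subset_Icc_self ht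
  have hnear {f : ℝ → ℝ} (hf : ContinuousOn f (Icc 0 T)) (h0 : 0 < f t) :
      ∃ δ > 0, ∀ s ∈ Icc t T, s < t + δ → 0 < f s := by
    obtain ⟨δ, hδ, h1⟩ := Metric.continuousOn_iff.1 hf t ht' (f t) h0
    refine ⟨δ, hδ, fun s hs hsδ => ?_⟩
    have := h1 s ⟨ht.1.trans hs.1, hs.2⟩
      (by rw [Real.dist_eq, abs_of_nonneg (sub_nonneg.2 hs.1)]; linarith)
    rw [Real.dist_eq] at this
    linarith [(abs_lt.1 this).1]
  have hpick {δ : ℝ} (hδ : 0 < δ) : ∃ s, t < s ∧ s ≤ c ∧ s ≤ T ∧ s < t + δ := by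
    refine ⟨min (min c T) (t + δ / 2), ?_, ?_, ?_, ?_⟩
    · exact lt_min (lt_min hc ht.2) (by linarith)
    · exact (min_le_left _ _).trans (min_le_left _ _)
    · exact (min_le_left _ _).trans (min_le_right _ _)
    · exact (min_le_right _ _).trans_lt (by linarith)
  rcases lt_or_ge (γ (b t)) (a t) with hab | hab
  · rw [max_eq_left hab.le] at hθ ⊢
    obtain ⟨δ₁, hδ₁, h1⟩ := hnear (h.continuousOn_fst.sub h.continuousOn_gain_snd) (sub_pos.2 hab)
    obtain ⟨δ₂, hδ₂, h2⟩ := hnear (h.continuousOn_fst.sub continuousOn_const) (sub_pos.2 hθ)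
    obtain ⟨s, hts, hsc, hsT, hs⟩ := hpick (lt_min hδ₁ hδ₂)
    have hdom : ∀ τ ∈ Icc t s, γ (b τ) ≤ a τ ∧ θ < a τ := fun τ hτ => by
      have h3 := h1 τ ⟨hτ.1, hτ.2.trans hsT⟩ (by linarith [hτ.2, min_le_left δ₁ δ₂])
      have h4 := h2 τ ⟨hτ.1, hτ.2.trans hsT⟩ (by linarith [hτ.2, min_le_right δ₁ δ₂])
      exact ⟨(sub_pos.1 h3).le, sub_pos.1 h4⟩
    refine ⟨s, ⟨hts, hsc⟩, hsT, ?_⟩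
    rw [max_eq_left (hdom s ⟨hts.le, le_rfl⟩).1]
    exact h.scale_fst_le ht' ⟨hts.le, hsT⟩ hdom
  · rw [max_eq_right hab] at hθ ⊢
    obtain ⟨δ₁, hδ₁, h1⟩ := h.decrease_snd t ht hab hθ
    obtain ⟨δ₂, hδ₂, h2⟩ := hnear (h.continuousOn_gain_snd.sub continuousOn_const) (sub_pos.2 hθ)
    obtain ⟨s, hts, hsc, hsT, hs⟩ := hpick (lt_min hδ₁ hδ₂)
    have hγb {τ : ℝ} (hτ : τ ∈ Icc t s) : θ < γ (b τ) :=
      sub_pos.1 (h2 τ ⟨hτ.1, hτ.2.trans hsT⟩ (by linarith [hτ.2, min_le_right δ₁ δ₂]))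
    have hsub {τ : ℝ} (hτ : τ ∈ Icc t s) : τ ∈ Icc 0 T := ⟨ht.1.trans hτ.1, hτ.2.trans hsT⟩
    have hts' : t ∈ Icc t s := ⟨le_rfl, hts.le⟩
    have hJ {τ : ℝ} (hτ : τ ∈ Icc t s) : F (γ (b τ)) + J (kInv γ (γ (b τ))) ≤
        F (γ (b t)) + J (kInv γ (γ (b t))) - (τ - t) := by
      have h3 := h1 τ ⟨hτ.1, hτ.2.trans hsT⟩ (by linarith [hτ.2, min_le_left δ₁ δ₂])
      have hpos {σ : ℝ} (hσ : σ ∈ Icc t s) : 0 < b σ := by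
        refine (h.nonneg_snd σ (hsub hσ)).lt_of_ne fun h0 => ?_
        have := hγb hσ
        rw [← h0, h.gain.map_zero] at this
        exact this.not_ge h.level_nonneg
      have h4 : b τ ≤ b t :=
        (h.strictMonoOn_snd.le_iff_le (hpos hτ) (hpos hts')).1 (by linarith [hτ.1])
      have h5 : F (γ (b τ)) ≤ F (γ (b t)) :=
        h.strictMonoOn_fst.monotoneOn (h.level_nonneg.trans_lt (hγb hτ))
          (h.level_nonneg.trans_lt (hγb hts')) (h.gain.toIsClassK.mono (hpos hτ).le h4)
      rw [h.gain.kInv_apply (hpos hτ).le, h.gain.kInv_apply (hpos hts').le]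
      linarith
    refine ⟨s, ⟨hts, hsc⟩, hsT, ?_⟩
    rcases le_or_gt (a s) (γ (b s)) with has | has
    · rw [max_eq_right has]
      exact hJ ⟨hts.le, le_rfl⟩
    · rw [max_eq_left has.le]
      have hcd : ContinuousOn (fun τ => a τ - γ (b τ)) (Icc t s) :=
        (h.continuousOn_fst.sub h.continuousOn_gain_snd).mono fun τ hτ => hsub hτ
      -- At the crossing time `r` both branches of the maximum agree, so the two estimates can be
      -- chained there however often dominance switched before.
      obtain ⟨r, hr, hr0, hrs⟩ := exists_last_nonpos hts.le hcd (sub_nonpos.2 hab) (sub_pos.2 has)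
      have hr' : r ∈ Icc t s := Ico_subset_Icc_self hr
      have hreq : a r = γ (b r) := sub_eq_zero.1 hr0
      have h6 := h.scale_fst_le (hsub hr') ⟨hr'.2, hsT⟩ fun τ hτ => by
        have h7 := hγb ⟨hr'.1.trans hτ.1, hτ.2⟩
        rcases hτ.1.eq_or_lt with rfl | hτr
        · exact ⟨hreq.ge, hreq ▸ h7⟩
        · have h8 := sub_pos.1 (hrs τ ⟨hτr, hτ.2⟩)
          exact ⟨h8.le, h7.trans h8⟩
      rw [hreq] at h6
      linarith [hJ hr']

/-- Continuous induction: the times at which `H (v τ) + τ` is at most its initial value form a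
closed set, and the local step moves to the right from each of them. -/
theorem scale_le_of_forall (h : CoupledDecrease γ F J a b θ T) {t s : ℝ} (ht : 0 ≤ t)
    (hts : t ≤ s) (hs : s ≤ T) (hθ : ∀ τ ∈ Icc t s, θ < max (a τ) (γ (b τ))) :
    F (max (a s) (γ (b s))) + J (kInv γ (max (a s) (γ (b s)))) ≤
      F (max (a t) (γ (b t))) + J (kInv γ (max (a t) (γ (b t)))) - (s - t) := by
  set v : ℝ → ℝ := fun τ => max (a τ) (γ (b τ))
  set H : ℝ → ℝ := fun r => F r + J (kInv γ r)
  have hv : ContinuousOn v (Icc t s) :=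
    (h.continuousOn_fst.sup h.continuousOn_gain_snd).mono (Icc_subset_Icc ht hs)
  have hH : ContinuousOn (fun τ => H (v τ) + τ) (Icc t s) :=
    (h.continuousOn_scale.comp hv fun τ hτ => h.level_nonneg.trans_lt (hθ τ hτ)).add continuousOn_id
  have hcl : IsClosed ({τ | H (v τ) + τ ≤ H (v t) + t} ∩ Icc t s) := by
    rw [inter_comm]
    exact hH.preimage_isClosed_of_isClosed isClosed_Icc isClosed_Iic
  have := hcl.Icc_subset_of_forall_exists_gt (mem_ofPred.2 le_rfl) (fun τ hτ c hc => ?_)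
    (right_mem_Icc.2 hts)
  · have : H (v s) + s ≤ H (v t) + t := this
    change H (v s) ≤ H (v t) - (s - t)
    linarith
  · have hτ1 : H (v τ) + τ ≤ H (v t) + t := hτ.1
    obtain ⟨r, hr, -, hr'⟩ := h.exists_gt_scale_le ⟨ht.trans hτ.2.1, hτ.2.2.trans_le hs⟩
      (hθ τ (Ico_subset_Icc_self hτ.2)) hc
    refine ⟨r, ?_, hr⟩
    change H (v r) + r ≤ H (v t) + t
    have : H (v r) ≤ H (v τ) - (r - τ) := hr'
    linarith

/-- As long as `max (a, γ b)` exceeds the level, it decreases at unit rate in the combined time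
scale. -/
theorem scale_le (h : CoupledDecrease γ F J a b θ T) (hT : 0 ≤ T)
    (hθ : θ < max (a T) (γ (b T))) : θ < max (a 0) (γ (b 0)) ∧
    F (max (a T) (γ (b T))) + J (kInv γ (max (a T) (γ (b T)))) ≤
      F (max (a 0) (γ (b 0))) + J (kInv γ (max (a 0) (γ (b 0)))) - T := by
  have hv : ContinuousOn (fun τ => max (a τ) (γ (b τ))) (Icc 0 T) :=
    h.continuousOn_fst.sup h.continuousOn_gain_snd
  -- The sublevel set is forward invariant: after a last time at level `θ` the maximum would be
  -- decreasing, and so could not exceed `θ` at time `T`.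
  have hall : ∀ τ ∈ Icc 0 T, θ < max (a τ) (γ (b τ)) := by
    by_contra! hcon
    obtain ⟨t, ht, htθ⟩ := hcon
    have hv' := hv.mono (Icc_subset_Icc_left ht.1)
    obtain ⟨r, hr, hr0, hrs⟩ := exists_last_nonpos ht.2 (hv'.sub continuousOn_const)
      (sub_nonpos.2 htθ) (sub_pos.2 hθ)
    have hmono : ∀ σ ∈ Ioc r T, max (a T) (γ (b T)) ≤ max (a σ) (γ (b σ)) := by
      intro σ hσ
      have h1 := h.scale_le_of_forall (ht.1.trans (hr.1.trans hσ.1.le)) hσ.2 le_rfl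
        fun τ hτ => sub_pos.1 (hrs τ ⟨hσ.1.trans_le hτ.1, hτ.2⟩)
      have h2 : StrictMonoOn (fun r => F r + J (kInv γ r)) (Ioi 0) :=
        h.strictMonoOn_fst.add h.strictMonoOn_snd_kInv
      refine (h2.le_iff_le (h.level_nonneg.trans_lt hθ)
        (h.level_nonneg.trans_lt (sub_pos.1 (hrs σ hσ)))).1 ?_
      simp only
      linarith [hσ.2]
    have h3 : ContinuousWithinAt (fun τ => max (a τ) (γ (b τ))) (Ioc r T) r :=
      (hv' r (Ico_subset_Icc_self hr)).mono fun τ hτ => ⟨hr.1.trans hτ.1.le, hτ.2⟩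
    have : (𝓝[Ioc r T] r).NeBot := by
      rw [nhdsWithin_Ioc_eq_nhdsGT hr.2]; infer_instance
    have h4 := ge_of_tendsto h3 (eventually_of_mem self_mem_nhdsWithin hmono)
    have h5 : max (a r) (γ (b r)) = θ := sub_eq_zero.1 hr0
    exact hθ.not_ge (h4.trans h5.le)
  refine ⟨hall 0 ⟨le_rfl, hT⟩, ?_⟩
  simpa using h.scale_le_of_forall le_rfl hT le_rfl hall

end CoupledDecrease

/-! ### The a priori estimate -/

theorem IsRegularDynamics.exists_norm_le {k l i j : ℕ} {g : Euc k → Euc l → Euc i → Euc j}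
    (hg : IsRegularDynamics g) (R : ℝ) :
    ∃ M, ∀ a b u, ‖a‖ ≤ R → ‖b‖ ≤ R → ‖u‖ ≤ R → ‖g a b u‖ ≤ M := by
  obtain ⟨L, hL⟩ := hg.lipschitz R
  obtain ⟨M, hM⟩ := hg.bounded_input 0 0 R
  refine ⟨M + |L| * (R + R), fun a b u ha hb hu => ?_⟩
  have hR : 0 ≤ R := (norm_nonneg a).trans ha
  have h1 := hL a 0 b 0 u ha (by simpa) hb (by simpa) hu
  rw [sub_zero, sub_zero] at h1
  have h2 : L * (‖a‖ + ‖b‖) ≤ |L| * (R + R) :=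
    mul_le_mul (le_abs_self L) (add_le_add ha hb) (by positivity) (abs_nonneg L)
  have h3 : ‖g a b u‖ ≤ ‖g a b u - g 0 0 u‖ + ‖g 0 0 u‖ := norm_le_norm_sub_add _ _
  linarith [hM u hu]

theorem norm_le_norm_fst_add_norm_snd {E E' : Type*} [SeminormedAddCommGroup E]
    [SeminormedAddCommGroup E'] (y : WithLp 2 (E × E')) : ‖y‖ ≤ ‖y.fst‖ + ‖y.snd‖ := by
  rw [WithLp.prod_norm_eq_of_L2, Real.sqrt_le_iff]
  exact ⟨by positivity, by nlinarith [norm_nonneg y.fst, norm_nonneg y.snd]⟩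

theorem fderiv_comp_fst_apply {E E' : Type*} [NormedAddCommGroup E] [NormedSpace ℝ E]
    [NormedAddCommGroup E'] [NormedSpace ℝ E'] {V : E → ℝ} (hV : ContDiff ℝ 1 V) (p v : E × E') :
    fderiv ℝ (fun p : E × E' => V p.1) p v = fderiv ℝ V p.1 v.1 := by
  have h1 : HasFDerivAt V (fderiv ℝ V p.1) p.1 :=
    (hV.differentiable one_ne_zero).differentiableAt.hasFDerivAt
  have h2 : HasFDerivAt (fun p : E × E' => V p.1) _ p := h1.comp p hasFDerivAt_fst
  rw [h2.fderiv]
  rfl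

theorem contDiff_uncurry_swap {E E' : Type*} [NormedAddCommGroup E] [NormedSpace ℝ E]
    [NormedAddCommGroup E'] [NormedSpace ℝ E'] {V : E' → E → ℝ}
    (hV : ContDiff ℝ 1 (Function.uncurry V)) : ContDiff ℝ 1 fun p : E × E' => V p.2 p.1 :=
  hV.comp (contDiff_snd.prodMk contDiff_fst)

/-- Separates the drift due to the slow motion from the stabilizing fast part; the hypotheses bound
these two partial derivatives individually. -/
theorem fderiv_uncurry_swap_apply {E E' : Type*} [NormedAddCommGroup E] [NormedSpace ℝ E]
    [NormedAddCommGroup E'] [NormedSpace ℝ E'] {V : E' → E → ℝ}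
    (hV : ContDiff ℝ 1 (Function.uncurry V)) (p v : E × E') :
    fderiv ℝ (fun p : E × E' => V p.2 p.1) p v =
      fderiv ℝ (fun x => V p.2 x) p.1 v.1 + fderiv ℝ (fun z => V z p.1) p.2 v.2 := by
  set f : E × E' → ℝ := fun p => V p.2 p.1
  have hd : HasFDerivAt f (fderiv ℝ f p) p :=
    ((contDiff_uncurry_swap hV).differentiable one_ne_zero).differentiableAt.hasFDerivAt
  have h1 : HasFDerivAt (fun x => V p.2 x) _ p.1 :=
    HasFDerivAt.comp (g := f) (f := fun x => (x, p.2)) p.1 hd (hasFDerivAt_prodMk_left p.1 p.2)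
  have h2 : HasFDerivAt (fun z => V z p.1) _ p.2 :=
    HasFDerivAt.comp (g := f) (f := fun z => (p.1, z)) p.2 hd (hasFDerivAt_prodMk_right p.1 p.2)
  rw [h1.fderiv, h2.fderiv]
  simp only [ContinuousLinearMap.comp_apply, ContinuousLinearMap.inl_apply,
    ContinuousLinearMap.inr_apply, ← map_add]
  simp

/-- The guaranteed decay rate of the fast Lyapunov function along the coupled system, when it
has the value `r` and the slow Lyapunov function the value `s`. -/
noncomputable def coupledFastRate (cs cf : ℝ) (G αs αf γs χs a l₁ l₂ : ℝ → ℝ) (r s : ℝ) : ℝ :=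
  cf * a r - cs * (G (kInv αs s + kInv αf r + γs (kInv χs r)) * (l₁ r + l₂ s))

/-- The level above which inputs bounded by `D` do not prevent the Lyapunov functions from
decreasing. -/
noncomputable def inputLevel (γs χs χf : ℝ → ℝ) (D : ℝ) : ℝ :=
  max (χs D) (max (γs (χf D)) (γs (χs (kInv γs D))))

theorem isClassK_inputLevel {γs χs χf : ℝ → ℝ} (hγ : IsClassKInf γs) (hχs : IsClassKInf χs)
    (hχf : IsClassKInf χf) : IsClassK (inputLevel γs χs χf) :=
  hχs.toIsClassK.max ((hγ.toIsClassK.comp hχf.toIsClassK).max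
    (hγ.toIsClassK.comp (hχs.toIsClassK.comp hγ.isClassK_kInv)))

/-- `ξ` is a solution on `[0, T]` of `ξ' = f (ξ, u)`, `ξ 0 = ξ₀`. -/
def IsSolutionOn {X U : Type*} [NormedAddCommGroup X] [NormedSpace ℝ X] (f : X → U → X)
    (u : ℝ → U) (ξ₀ : X) (T : ℝ) (ξ : ℝ → X) : Prop :=
  ContinuousOn ξ (Icc 0 T) ∧ ∀ t ∈ Icc 0 T,
    IntervalIntegrable (fun s => f (ξ s) (u s)) volume 0 t ∧
      ξ t = ξ₀ + ∫ s in (0 : ℝ)..t, f (ξ s) (u s)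

/-! ### Lyapunov decay along the coupled system -/

section Estimate

variable {n m p q : ℕ} {gs : Euc n → Euc m → Euc p → Euc n} {gf : Euc m → Euc n → Euc q → Euc m}
  {φ : Euc n → Euc m} {Vs : Euc n → ℝ} {Vf : Euc m → Euc n → ℝ}
  {αsLow αsUp γs χs αs αfLow αfUp χf αf l₁ l₂ G : ℝ → ℝ} {c₀ cs cf : ℝ}

theorem IsSlowLyapunov.nonneg (hs : IsSlowLyapunov gs Vs Vf αsLow αsUp γs χs αs) (x : Euc n) :
    0 ≤ Vs x := (hs.low.toIsClassK.nonneg (norm_nonneg x)).trans (hs.bounds x).1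

theorem IsFastLyapunov.nonneg (hf : IsFastLyapunov gf φ Vs Vf αfLow αfUp χf αf l₁ l₂)
    (z : Euc m) (x : Euc n) : 0 ≤ Vf z x :=
  (hf.low.toIsClassK.nonneg (norm_nonneg _)).trans (hf.bounds z x).1

/-- The fast velocity `v` is arbitrary because `Vs` depends on `x` alone. Capping the rate by `Vs`
only weakens the bound. -/
theorem slow_decay (hs : IsSlowLyapunov gs Vs Vf αsLow αsUp γs χs αs) (hcs : 0 < cs)
    {D : ℝ} {x : Euc n} {z : Euc m} {d : Euc p} (hd : ‖d‖ ≤ D)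
    (hdom : γs (Vf z x) ≤ Vs x) (hlev : inputLevel γs χs χf D < Vs x) (v : Euc m) :
    fderiv ℝ (fun y : Euc n × Euc m => Vs y.1) (x, z) (cs • gs x z d, v) ≤
      -min (cs * αs (Vs x)) (Vs x) := by
  rw [fderiv_comp_fst_apply hs.contDiff]
  have h1 : χs ‖d‖ ≤ Vs x :=
    (hs.inputGain.toIsClassK.mono (norm_nonneg d) hd).trans ((le_max_left _ _).trans hlev.le)
  have h2 := mul_le_mul_of_nonneg_left (hs.decay x z d (max_le hdom h1)) hcs.le
  simp only [map_smul, smul_eq_mul]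
  linarith [min_le_left (cs * αs (Vs x)) (Vs x)]

/-- The rate is evaluated at the true value of `Vs`, without assuming `Vs ≤ γs (Vf)`. The bound
therefore stays available when `Vs` slightly exceeds `γs (Vf)` just after a time of fast dominance.
-/
theorem fast_decay (hs : IsSlowLyapunov gs Vs Vf αsLow αsUp γs χs αs)
    (hf : IsFastLyapunov gf φ Vs Vf αfLow αfUp χf αf l₁ l₂) (hG : IsClassKInf G)
    (hgG : ∀ x z d, ‖gs x z d‖ ≤ G (‖x‖ + ‖z - φ x‖ + ‖d‖)) (hcs : 0 < cs) (hcf : 0 < cf)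
    {D : ℝ} {x : Euc n} {z : Euc m} {d : Euc p} {w : Euc q} (hd : ‖d‖ ≤ D) (hw : ‖w‖ ≤ D)
    (hlev : inputLevel γs χs χf D < γs (Vf z x)) :
    fderiv ℝ (fun y : Euc n × Euc m => Vf y.2 y.1) (x, z) (cs • gs x z d, cf • gf z x w) ≤
      -coupledFastRate cs cf G αsLow αfLow γs χs αf l₁ l₂ (Vf z x) (Vs x) := by
  have hD : 0 ≤ D := (norm_nonneg d).trans hd
  have hγ := hs.gain.toIsClassK
  have hV := hf.nonneg z x
  have hU := hs.nonneg x
  rw [fderiv_uncurry_swap_apply hf.contDiff]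
  have h1 : χf ‖w‖ ≤ Vf z x := by
    refine (hf.inputGain.toIsClassK.mono (norm_nonneg w) hw).trans ?_
    rw [← hγ.le_iff_le (hf.inputGain.toIsClassK.nonneg hD) hV]
    exact ((le_max_left _ _).trans (le_max_right _ _)).trans hlev.le
  -- The third term of the input level is made for this: it replaces the disturbance in the bound on
  -- `gs` by a function of `Vf`.
  have h2 : ‖d‖ ≤ γs (kInv χs (Vf z x)) := by
    refine hd.trans ?_
    rw [← hs.gain.kInv_le_iff (hs.inputGain.kInv_nonneg hV) hD,
      hs.inputGain.le_kInv_iff (hs.gain.kInv_nonneg hD) hV,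
      ← hγ.le_iff_le (hs.inputGain.toIsClassK.nonneg (hs.gain.kInv_nonneg hD)) hV]
    exact ((le_max_right _ _).trans (le_max_right _ _)).trans hlev.le
  have h3 : ‖x‖ ≤ kInv αsLow (Vs x) := (hs.low.le_kInv_iff (norm_nonneg x) hU).2 (hs.bounds x).1
  have h4 : ‖z - φ x‖ ≤ kInv αfLow (Vf z x) :=
    (hf.low.le_kInv_iff (norm_nonneg _) hV).2 (hf.bounds z x).1
  have h5 : ‖gs x z d‖ ≤ G (kInv αsLow (Vs x) + kInv αfLow (Vf z x) + γs (kInv χs (Vf z x))) :=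
    (hgG x z d).trans (hG.toIsClassK.mono (by positivity) (add_le_add (add_le_add h3 h4) h2))
  have h6 : fderiv ℝ (fun x' => Vf z x') x (gs x z d) ≤
      G (kInv αsLow (Vs x) + kInv αfLow (Vf z x) + γs (kInv χs (Vf z x))) *
        (l₁ (Vf z x) + l₂ (Vs x)) := by
    refine ((Real.le_norm_self _).trans (ContinuousLinearMap.le_opNorm _ _)).trans ?_
    rw [mul_comm]
    exact mul_le_mul h5 (hf.growth z x) (norm_nonneg _) ((norm_nonneg _).trans h5)
  have h7 := mul_le_mul_of_nonneg_left h6 hcs.le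
  have h8 := mul_le_mul_of_nonneg_left (hf.decay z x w h1) hcf.le
  simp only [map_smul, smul_eq_mul, coupledFastRate]
  linarith

/-- On the diagonal `s = γs r` the rate is `cf αf - cs ḡs λ̄f`, which is the condition on `c₀`
multiplied by `cf`. -/
theorem coupledFastRate_pos
    (hcond : ∀ r, 0 < r → c₀ * gBar G αsLow αfLow γs χs r * lambdaBar l₁ l₂ γs r < αf r)
    (hcf : 0 < cf) (hc : cs / cf = c₀) {r : ℝ} (hr : 0 < r) :
    0 < coupledFastRate cs cf G αsLow αfLow γs χs αf l₁ l₂ r (γs r) := by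
  have h1 := mul_lt_mul_of_pos_left (hcond r hr) hcf
  have h2 : cf * c₀ = cs := by rw [← hc]; field_simp
  rw [mul_assoc, ← mul_assoc cf, h2] at h1
  exact sub_pos.2 h1

/-- A larger slow value can only increase the drift, because `G`, the inverse of `αsLow` and `l₂`
are nondecreasing. Under fast dominance the diagonal `s = γs r` is thus the worst case. -/
theorem coupledFastRate_anti (hs : IsSlowLyapunov gs Vs Vf αsLow αsUp γs χs αs)
    (hf : IsFastLyapunov gf φ Vs Vf αfLow αfUp χf αf l₁ l₂) (hl₂ : MonotoneOn l₂ (Ici 0))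
    (hG : IsClassKInf G) (hcs : 0 < cs) {r s s' : ℝ} (hr : 0 ≤ r) (hs0 : 0 ≤ s) (hss : s ≤ s') :
    coupledFastRate cs cf G αsLow αfLow γs χs αf l₁ l₂ r s' ≤
      coupledFastRate cs cf G αsLow αfLow γs χs αf l₁ l₂ r s := by
  have hs0' : 0 ≤ s' := hs0.trans hss
  have h0 : 0 ≤ kInv αsLow s + kInv αfLow r + γs (kInv χs r) :=
    add_nonneg (add_nonneg (hs.low.kInv_nonneg hs0) (hf.low.kInv_nonneg hr))
      (hs.gain.toIsClassK.nonneg (hs.inputGain.kInv_nonneg hr))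
  have h1 : kInv αsLow s + kInv αfLow r + γs (kInv χs r) ≤
      kInv αsLow s' + kInv αfLow r + γs (kInv χs r) := by
    gcongr
    exact hs.low.isClassK_kInv.mono hs0 hss
  refine sub_le_sub_left (mul_le_mul_of_nonneg_left (mul_le_mul (hG.toIsClassK.mono h0 h1)
    (add_le_add_right (hl₂ hs0 hs0' hss) _) ?_ (hG.toIsClassK.nonneg (h0.trans h1))) hcs.le) _
  exact add_nonneg (hf.pd₁.nonneg hr) (hf.pd₂.nonneg hs0)

theorem continuousOn_coupledFastRate (hs : IsSlowLyapunov gs Vs Vf αsLow αsUp γs χs αs)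
    (hf : IsFastLyapunov gf φ Vs Vf αfLow αfUp χf αf l₁ l₂) (hG : IsClassKInf G)
    {S : Set ℝ} {a b : ℝ → ℝ} (ha : ContinuousOn a S) (hb : ContinuousOn b S)
    (ha0 : ∀ t ∈ S, 0 ≤ a t) (hb0 : ∀ t ∈ S, 0 ≤ b t) :
    ContinuousOn (fun t => coupledFastRate cs cf G αsLow αfLow γs χs αf l₁ l₂ (b t) (a t)) S := by
  have h1 : ContinuousOn (fun t => kInv αsLow (a t)) S :=
    hs.low.isClassK_kInv.continuousOn_comp ha ha0
  have h2 : ContinuousOn (fun t => kInv αfLow (b t)) S :=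
    hf.low.isClassK_kInv.continuousOn_comp hb hb0
  have h3 : ContinuousOn (fun t => γs (kInv χs (b t))) S :=
    (hs.gain.toIsClassK.comp hs.inputGain.isClassK_kInv).continuousOn_comp hb hb0
  have h4 : ContinuousOn
      (fun t => G (kInv αsLow (a t) + kInv αfLow (b t) + γs (kInv χs (b t)))) S :=
    hG.toIsClassK.continuousOn_comp ((h1.add h2).add h3) fun t ht =>
      add_nonneg (add_nonneg (hs.low.kInv_nonneg (ha0 t ht)) (hf.low.kInv_nonneg (hb0 t ht)))
        (hs.gain.toIsClassK.nonneg (hs.inputGain.kInv_nonneg (hb0 t ht)))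
  exact (continuousOn_const.mul (hf.rate.continuousOn_comp hb hb0)).sub
    (continuousOn_const.mul (h4.mul ((hf.pd₁.continuousOn_comp hb hb0).add
      (hf.pd₂.continuousOn_comp ha ha0))))

/-- Along solutions the two Lyapunov functions satisfy the comparison argument. -/
theorem coupledDecrease_of_isSolutionOn (hgs : IsRegularDynamics gs) (hgf : IsRegularDynamics gf)
    (hs : IsSlowLyapunov gs Vs Vf αsLow αsUp γs χs αs)
    (hf : IsFastLyapunov gf φ Vs Vf αfLow αfUp χf αf l₁ l₂) (hl₂ : MonotoneOn l₂ (Ici 0))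
    (hG : IsClassKInf G) (hgG : ∀ x z d, ‖gs x z d‖ ≤ G (‖x‖ + ‖z - φ x‖ + ‖d‖))
    (hcond : ∀ r, 0 < r → c₀ * gBar G αsLow αfLow γs χs r * lambdaBar l₁ l₂ γs r < αf r)
    (hcs : 0 < cs) (hcf : 0 < cf) (hc : cs / cf = c₀) {F J : ℝ → ℝ}
    (hFm : StrictMonoOn F (Ioi 0)) (hJm : StrictMonoOn J (Ioi 0))
    (hF : ∀ r, 0 < r → HasDerivAt F (min (cs * αs r) r)⁻¹ r)
    (hJ : ∀ r, 0 < r →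
      HasDerivAt J (coupledFastRate cs cf G αsLow αfLow γs χs αf l₁ l₂ r (γs r) / 2)⁻¹ r)
    {ξ₀ : WithLp 2 (Euc n × Euc m)} {u : ℝ → WithLp 2 (Euc p × Euc q)} {T D : ℝ} (hT : 0 ≤ T)
    (hD : 0 ≤ D) (hu : ∀ᵐ t, t ∈ Icc 0 T → ‖u t‖ ≤ D) {ξ : ℝ → WithLp 2 (Euc n × Euc m)}
    (hξ : IsSolutionOn (perturbedSystem (fun _ _ _ => cs) (fun _ _ _ => cf) gs gf) u ξ₀ T ξ) :
    CoupledDecrease γs F J (fun t => Vs (ξ t).fst) (fun t => Vf (ξ t).snd (ξ t).fst)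
      (inputLevel γs χs χf D) T := by
  -- Half of the diagonal rate leaves a strict margin, so the decay survives on a neighbourhood of
  -- any time at which `γs (Vf)` dominates.
  set κ : ℝ → ℝ := fun r => coupledFastRate cs cf G αsLow αfLow γs χs αf l₁ l₂ r (γs r) / 2
  let e := WithLp.prodContinuousLinearEquiv 2 ℝ (Euc n) (Euc m)
  let f := perturbedSystem (fun _ _ _ => cs) (fun _ _ _ => cf) gs gf
  let η : ℝ → Euc n × Euc m := fun t => ((ξ t).fst, (ξ t).snd)
  let v : ℝ → Euc n × Euc m := fun t =>
    (cs • gs (ξ t).fst (ξ t).snd (u t).fst, cf • gf (ξ t).snd (ξ t).fst (u t).snd)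
  have hηc : ContinuousOn η (Icc 0 T) := e.continuous.comp_continuousOn hξ.1
  have hvi : IntervalIntegrable v volume 0 T := by
    have := (hξ.2 T ⟨hT, le_rfl⟩).1
    exact ⟨e.toContinuousLinearMap.integrable_comp this.1,
      e.toContinuousLinearMap.integrable_comp this.2⟩
  have hη0 : ∀ t ∈ Icc 0 T, η t = η 0 + ∫ s in (0 : ℝ)..t, v s := by
    intro t ht
    have h1 := (hξ.2 0 ⟨le_rfl, hT⟩).2
    rw [intervalIntegral.integral_same, add_zero] at h1
    have h2 := (hξ.2 t ht).2
    rw [← h1] at h2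
    have h3 := e.toContinuousLinearMap.intervalIntegral_comp_comm (hξ.2 t ht).1
    calc η t = e (ξ t) := rfl
      _ = e (ξ 0 + ∫ s in (0 : ℝ)..t, f (ξ s) (u s)) := congrArg e h2
      _ = e (ξ 0) + e (∫ s in (0 : ℝ)..t, f (ξ s) (u s)) := map_add e _ _
      _ = η 0 + ∫ s in (0 : ℝ)..t, v s := congrArg (e (ξ 0) + ·) h3.symm
  obtain ⟨M, hM⟩ : ∃ M, ∀ᵐ t, t ∈ Icc 0 T → ‖v t‖ ≤ M := by
    obtain ⟨R, hR⟩ := isCompact_Icc.exists_bound_of_continuousOn hηc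
    obtain ⟨M₁, hM₁⟩ := hgs.exists_norm_le (max R D)
    obtain ⟨M₂, hM₂⟩ := hgf.exists_norm_le (max R D)
    refine ⟨max (cs * M₁) (cf * M₂), ?_⟩
    filter_upwards [hu] with t hut ht
    have h1 := (norm_fst_le (η t)).trans ((hR t ht).trans (le_max_left R D))
    have h2 := (norm_snd_le (η t)).trans ((hR t ht).trans (le_max_left R D))
    have h3 := (WithLp.norm_fst_le _ (u t)).trans ((hut ht).trans (le_max_right R D))
    have h4 := (WithLp.norm_snd_le _ (u t)).trans ((hut ht).trans (le_max_right R D))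
    refine (Prod.norm_mk _ _).le.trans (max_le_max ?_ ?_)
    · rw [norm_smul, Real.norm_of_nonneg hcs.le]
      exact mul_le_mul_of_nonneg_left (hM₁ _ _ _ h1 h2 h3) hcs.le
    · rw [norm_smul, Real.norm_of_nonneg hcf.le]
      exact mul_le_mul_of_nonneg_left (hM₂ _ _ _ h2 h1 h4) hcf.le
  have hsub {t s : ℝ} (ht : t ∈ Icc 0 T) (hs : s ∈ Icc t T) :
      IntervalIntegrable v volume t s ∧ (∀ τ ∈ Icc t s, η τ = η t + ∫ σ in t..τ, v σ) ∧
        ∀ᵐ τ, τ ∈ Icc t s → ‖v τ‖ ≤ M := by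
    have hs' : s ∈ Icc 0 T := ⟨ht.1.trans hs.1, hs.2⟩
    refine ⟨hvi.mono_set (uIcc_subset_uIcc (Icc_subset_uIcc ht) (Icc_subset_uIcc hs')),
      fun τ hτ => ?_, ?_⟩
    · rw [← (norm_sub_le_of_eq_integral hvi hη0 hM ht ⟨ht.1.trans hτ.1, hτ.2.trans hs.2⟩ hτ.1).1]
      abel
    · filter_upwards [hM] with τ h hτ using h ⟨ht.1.trans hτ.1, hτ.2.trans hs.2⟩
  have hVsc : ContDiff ℝ 1 fun y : Euc n × Euc m => Vs y.1 := hs.contDiff.comp contDiff_fst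
  have hVfc : ContDiff ℝ 1 fun y : Euc n × Euc m => Vf y.2 y.1 := contDiff_uncurry_swap hf.contDiff
  have hac : ContinuousOn (fun t => Vs (ξ t).fst) (Icc 0 T) :=
    hVsc.continuous.comp_continuousOn hηc
  have hbc : ContinuousOn (fun t => Vf (ξ t).snd (ξ t).fst) (Icc 0 T) :=
    hVfc.continuous.comp_continuousOn hηc
  have hlev : 0 ≤ inputLevel γs χs χf D :=
    (isClassK_inputLevel hs.gain hs.inputGain hf.inputGain).nonneg hD
  have hκp : ∀ r, 0 < r → 0 < κ r := fun r hr => half_pos (coupledFastRate_pos hcond hcf hc hr)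
  have hκc : ContinuousOn κ (Ici 0) :=
    (continuousOn_coupledFastRate hs hf hG hs.gain.continuousOn continuousOn_id
      (fun r hr => hs.gain.toIsClassK.nonneg hr) fun r hr => hr).div_const 2
  have hαp : ∀ r, 0 < r → 0 < min (cs * αs r) r := fun r hr =>
    lt_min (mul_pos hcs (hs.rate.pos r hr)) hr
  have hαc : ContinuousOn (fun r => min (cs * αs r) r) (Ioi 0) :=
    ((continuousOn_const.mul hs.rate.continuousOn).inf continuousOn_id).mono Ioi_subset_Ici_self
  have hFc : ContinuousOn F (Ioi 0) := fun r hr => (hF r hr).continuousAt.continuousWithinAt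
  have hJc : ContinuousOn J (Ioi 0) := fun r hr => (hJ r hr).continuousAt.continuousWithinAt
  have hud : ∀ᵐ t, t ∈ Icc 0 T → ‖(u t).fst‖ ≤ D ∧ ‖(u t).snd‖ ≤ D := by
    filter_upwards [hu] with t hut ht
    exact ⟨(WithLp.norm_fst_le _ (u t)).trans (hut ht),
      (WithLp.norm_snd_le _ (u t)).trans (hut ht)⟩
  refine ⟨hs.gain, hFm, hJm, hFc.add (hJc.comp (hs.gain.isClassK_kInv.continuousOn.mono
    Ioi_subset_Ici_self) fun r hr => hs.gain.isClassK_kInv.pos hr), hlev, hac, hbc,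
    fun t _ => hf.nonneg _ _, fun t ht s hs' hdom => ?_, fun t ht hab hθ => ?_⟩
  · obtain ⟨h1, h2, h3⟩ := hsub ht hs'
    refine timeScale_le_sub hVsc hαc hαp hF hs'.1 h1 h2 h3
      (fun τ hτ => hlev.trans_lt (hdom τ hτ).2) ?_
    filter_upwards [hud] with τ huτ hτ
    exact slow_decay hs hcs (huτ ⟨ht.1.trans hτ.1, hτ.2.trans hs'.2⟩).1 (hdom τ hτ).1
      (hdom τ hτ).2 _
  · have ht' : t ∈ Icc 0 T := Ico_subset_Icc_self ht
    have hbt : 0 < Vf (ξ t).snd (ξ t).fst := by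
      refine (hf.nonneg _ _).lt_of_ne fun h0 => ?_
      rw [← h0, hs.gain.map_zero] at hθ
      exact hθ.not_ge hlev
    have hrc := (continuousOn_coupledFastRate (cs := cs) (cf := cf) hs hf hG hac hbc
      (fun t _ => hs.nonneg _) fun t _ => hf.nonneg _ _).sub
        (hκc.comp hbc fun t _ => hf.nonneg _ _)
    have hr0 := coupledFastRate_anti (cf := cf) hs hf hl₂ hG hcs hbt.le (hs.nonneg _) hab
    have hκt := hκp _ hbt
    have hr1 : 0 < coupledFastRate cs cf G αsLow αfLow γs χs αf l₁ l₂
        (Vf (ξ t).snd (ξ t).fst) (Vs (ξ t).fst) - κ (Vf (ξ t).snd (ξ t).fst) := by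
      simp only [κ] at hκt ⊢
      linarith
    have hθc := (hs.gain.toIsClassK.continuousOn_comp hbc fun t _ => hf.nonneg _ _).sub
      (continuousOn_const (c := inputLevel γs χs χf D))
    -- The tolerance is the margin itself, so the actual rate stays above `κ`; the next line
    -- likewise keeps `γs (Vf)` above the input level.
    obtain ⟨δ₁, hδ₁, h1⟩ := Metric.continuousOn_iff.1 hrc t ht' _ hr1
    obtain ⟨δ₂, hδ₂, h2⟩ := Metric.continuousOn_iff.1 hθc t ht' _ (sub_pos.2 hθ)
    refine ⟨min δ₁ δ₂, lt_min hδ₁ hδ₂, fun s hs' hsδ => ?_⟩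
    have hloc : ∀ τ ∈ Icc t s, κ (Vf (ξ τ).snd (ξ τ).fst) <
        coupledFastRate cs cf G αsLow αfLow γs χs αf l₁ l₂
          (Vf (ξ τ).snd (ξ τ).fst) (Vs (ξ τ).fst) ∧
        inputLevel γs χs χf D < γs (Vf (ξ τ).snd (ξ τ).fst) := by
      intro τ hτ
      have hτ' : τ ∈ Icc 0 T := ⟨ht.1.trans hτ.1, hτ.2.trans hs'.2⟩
      have hdist : dist τ t < min δ₁ δ₂ := by
        rw [Real.dist_eq, abs_of_nonneg (sub_nonneg.2 hτ.1)]
        linarith [hτ.2]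
      have h3 := (abs_lt.1 (h1 τ hτ' (hdist.trans_le (min_le_left _ _)))).1
      have h4 := (abs_lt.1 (h2 τ hτ' (hdist.trans_le (min_le_right _ _)))).1
      simp only [Pi.sub_apply, Function.comp_apply] at h3 h4
      constructor <;> linarith
    obtain ⟨h3, h4, h5⟩ := hsub ht' hs'
    refine timeScale_le_sub hVfc (hκc.mono Ioi_subset_Ici_self) hκp hJ hs'.1 h3 h4 h5
      (fun τ hτ => ?_) ?_
    · refine (hf.nonneg _ _).lt_of_ne fun h0 => ?_
      have := (hloc τ hτ).2
      rw [show Vf (ξ τ).snd (ξ τ).fst = 0 from h0.symm, hs.gain.map_zero] at this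
      exact this.not_ge hlev
    · filter_upwards [hud] with τ huτ hτ
      obtain ⟨h6, h7⟩ := huτ ⟨ht.1.trans hτ.1, hτ.2.trans hs'.2⟩
      refine (fast_decay hs hf hG hgG hcs hcf h6 h7 (hloc τ hτ).2).trans ?_
      exact neg_le_neg (hloc τ hτ).1.le

/-- The estimate of input-to-state stability, on finite time horizons. -/
theorem exists_estimate_of_isSolutionOn (hgs : IsRegularDynamics gs) (hgf : IsRegularDynamics gf)
    (hφ : Continuous φ) (hs : IsSlowLyapunov gs Vs Vf αsLow αsUp γs χs αs)
    (hf : IsFastLyapunov gf φ Vs Vf αfLow αfUp χf αf l₁ l₂) (hl₂ : MonotoneOn l₂ (Ici 0))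
    (hG : IsClassKInf G) (hgG : ∀ x z d, ‖gs x z d‖ ≤ G (‖x‖ + ‖z - φ x‖ + ‖d‖))
    (hcond : ∀ r, 0 < r → c₀ * gBar G αsLow αfLow γs χs r * lambdaBar l₁ l₂ γs r < αf r)
    (hcs : 0 < cs) (hcf : 0 < cf) (hc : cs / cf = c₀) :
    ∃ (β : ℝ → ℝ → ℝ) (χ : ℝ → ℝ), IsClassKL β ∧ IsClassK χ ∧
      ∀ (ξ₀ : WithLp 2 (Euc n × Euc m)) (u : ℝ → WithLp 2 (Euc p × Euc q)) (T D : ℝ)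
        (ξ : ℝ → WithLp 2 (Euc n × Euc m)), 0 ≤ T → 0 ≤ D → (∀ᵐ t, t ∈ Icc 0 T → ‖u t‖ ≤ D) →
        IsSolutionOn (perturbedSystem (fun _ _ _ => cs) (fun _ _ _ => cf) gs gf) u ξ₀ T ξ →
        ‖ξ T - pair 0 (φ 0)‖ ≤ max (β ‖ξ₀ - pair 0 (φ 0)‖ T) (χ D) := by
  obtain ⟨ω, hω, hφω⟩ := exists_isClassK_norm_sub_le hφ
  have hγ := hs.gain.toIsClassK
  have hγi := hs.gain.isClassK_kInv
  have hκp : ∀ r, 0 < r →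
      0 < coupledFastRate cs cf G αsLow αfLow γs χs αf l₁ l₂ r (γs r) / 2 :=
    fun r hr => half_pos (coupledFastRate_pos hcond hcf hc hr)
  have hκc : ContinuousOn
      (fun r => coupledFastRate cs cf G αsLow αfLow γs χs αf l₁ l₂ r (γs r) / 2) (Ioi 0) :=
    ((continuousOn_coupledFastRate hs hf hG hs.gain.continuousOn continuousOn_id
      (fun r hr => hγ.nonneg hr) fun r hr => hr).div_const 2).mono Ioi_subset_Ici_self
  have hαp : ∀ r, 0 < r → 0 < min (cs * αs r) r := fun r hr =>
    lt_min (mul_pos hcs (hs.rate.pos r hr)) hr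
  have hαc : ContinuousOn (fun r => min (cs * αs r) r) (Ioi 0) :=
    ((continuousOn_const.mul hs.rate.continuousOn).inf continuousOn_id).mono Ioi_subset_Ici_self
  obtain ⟨F, hF1, hFm, hF⟩ := exists_hasDerivAt_inv hαc hαp one_pos
  -- Basing `J` at `γs⁻¹ 1` and `F` at `1` makes the combined scale vanish at `1`, where it is
  -- compared with the logarithm.
  obtain ⟨J, hJ1, hJm, hJ⟩ := exists_hasDerivAt_inv hκc hκp (hγi.pos one_pos)
  have hFlog := monotoneOn_sub_log hαp (fun r _ => min_le_right _ _) hF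
  have hJi : StrictMonoOn (fun r => J (kInv γs r)) (Ioi 0) := fun r hr s hs' hrs =>
    hJm (hγi.pos hr) (hγi.pos hs') (hγi.strictMonoOn (mem_Ici.2 (le_of_lt hr))
      (mem_Ici.2 (le_of_lt hs')) hrs)
  have hHc : ContinuousOn (fun r => F r + J (kInv γs r)) (Ioi 0) :=
    ContinuousOn.add (fun r hr => (hF r hr).continuousAt.continuousWithinAt)
      (ContinuousOn.comp (t := Ioi 0) (fun r hr => (hJ r hr).continuousAt.continuousWithinAt)
        (hγi.continuousOn.mono Ioi_subset_Ici_self) fun r hr => hγi.pos hr)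
  obtain ⟨β, hβ, hβle⟩ := exists_isClassKL_of_le_sub hHc (hFm.add hJi) (fun r hr hr1 => by
      have h1 := hFlog hr (mem_Ioi.2 one_pos) hr1
      have h2 := hJi.monotoneOn hr (mem_Ioi.2 one_pos) hr1
      simp only [hF1, Real.log_one, hJ1] at h1 h2
      linarith) fun r hr1 => by
      have h1 := hFlog (mem_Ioi.2 one_pos) (mem_Ioi.2 <| one_pos.trans_le hr1) hr1
      have h2 := hJi.monotoneOn (mem_Ioi.2 one_pos) (mem_Ioi.2 <| one_pos.trans_le hr1) hr1
      simp only [hF1, Real.log_one, hJ1] at h1 h2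
      linarith
  -- `Ψ` recovers the state from `v`, and `Φ` bounds `v` by the state. The function `ω` pays for
  -- replacing `φ x` by `φ 0`.
  let Ψ : ℝ → ℝ := fun r => kInv αsLow r + ω (kInv αsLow r) + kInv αfLow (kInv γs r)
  let Φ : ℝ → ℝ := fun r => max (αsUp r) (γs (αfUp (r + ω r)))
  have hΨ : IsClassK Ψ := (hs.low.isClassK_kInv.add (hω.comp hs.low.isClassK_kInv)).add
    (hf.low.isClassK_kInv.comp hγi)
  have hΦ : IsClassK Φ := hs.up.toIsClassK.max (hγ.comp (hf.up.toIsClassK.comp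
    (isClassK_id.add hω)))
  have hΘ := isClassK_inputLevel hs.gain hs.inputGain hf.inputGain
  have hlow (y : WithLp 2 (Euc n × Euc m)) :
      ‖y - pair 0 (φ 0)‖ ≤ Ψ (max (Vs y.fst) (γs (Vf y.snd y.fst))) := by
    have hv0 : 0 ≤ max (Vs y.fst) (γs (Vf y.snd y.fst)) := (hs.nonneg _).trans (le_max_left _ _)
    have h1 : ‖y.fst‖ ≤ kInv αsLow (max (Vs y.fst) (γs (Vf y.snd y.fst))) :=
      (hs.low.le_kInv_iff (norm_nonneg _) hv0).2 ((hs.bounds _).1.trans (le_max_left _ _))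
    have h2 : ‖y.snd - φ y.fst‖ ≤
        kInv αfLow (kInv γs (max (Vs y.fst) (γs (Vf y.snd y.fst)))) := by
      refine (hf.low.le_kInv_iff (norm_nonneg _) (hs.gain.kInv_nonneg hv0)).2
        ((hf.bounds _ _).1.trans ?_)
      exact (hs.gain.le_kInv_iff (hf.nonneg _ _) hv0).2 (le_max_right _ _)
    have h3 : ‖φ y.fst - φ 0‖ ≤ ω (kInv αsLow (max (Vs y.fst) (γs (Vf y.snd y.fst)))) :=
      (hφω _).trans (hω.mono (norm_nonneg _) h1)
    have h4 : ‖y - pair 0 (φ 0)‖ ≤ ‖y.fst‖ + ‖y.snd - φ 0‖ := by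
      have := norm_le_norm_fst_add_norm_snd (y - pair 0 (φ 0))
      have h0 : (y - pair 0 (φ 0)).fst = y.fst := sub_zero _
      rwa [h0] at this
    have h5 : ‖y.snd - φ 0‖ ≤ ‖y.snd - φ y.fst‖ + ‖φ y.fst - φ 0‖ := 
      norm_sub_le_norm_sub_add_norm_sub _ _ _
    simp only [Ψ]
    linarith
  have hupp (y : WithLp 2 (Euc n × Euc m)) :
      max (Vs y.fst) (γs (Vf y.snd y.fst)) ≤ Φ ‖y - pair 0 (φ 0)‖ := by
    have h1 : ‖y.fst‖ ≤ ‖y - pair 0 (φ 0)‖ := by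
      have := WithLp.norm_fst_le _ (y - pair 0 (φ 0))
      simpa using this
    have h2 : ‖y.snd - φ 0‖ ≤ ‖y - pair 0 (φ 0)‖ := by
      have := WithLp.norm_snd_le _ (y - pair 0 (φ 0))
      simpa using this
    have h3 : ‖y.snd - φ y.fst‖ ≤ ‖y.snd - φ 0‖ + ‖φ y.fst - φ 0‖ := by
      rw [norm_sub_rev (φ y.fst)]
      exact norm_sub_le_norm_sub_add_norm_sub _ _ _
    have h4 : ‖φ y.fst - φ 0‖ ≤ ω ‖y - pair 0 (φ 0)‖ := (hφω _).trans (hω.mono (norm_nonneg _) h1)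
    refine max_le_max ((hs.bounds _).2.trans (hs.up.toIsClassK.mono (norm_nonneg _) h1)) ?_
    refine hγ.mono (hf.nonneg _ _) ((hf.bounds _ _).2.trans
      (hf.up.toIsClassK.mono (norm_nonneg _) ?_))
    linarith
  refine ⟨fun s t => Ψ (β (Φ s) t), fun D => Ψ (inputLevel γs χs χf D), hβ.comp hΨ hΦ,
    hΨ.comp hΘ, fun ξ₀ u T D ξ hT hD hu hξ => ?_⟩
  have hcd := coupledDecrease_of_isSolutionOn hgs hgf hs hf hl₂ hG hgG hcond hcs hcf hc hFm hJm
    hF hJ hT hD hu hξ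
  have hξ0 : ξ 0 = ξ₀ := by
    have := (hξ.2 0 ⟨le_rfl, hT⟩).2
    rwa [intervalIntegral.integral_same, add_zero] at this
  have hvT : 0 ≤ max (Vs (ξ T).fst) (γs (Vf (ξ T).snd (ξ T).fst)) :=
    (hs.nonneg _).trans (le_max_left _ _)
  refine (hlow (ξ T)).trans ?_
  rcases le_or_gt (max (Vs (ξ T).fst) (γs (Vf (ξ T).snd (ξ T).fst))) (inputLevel γs χs χf D)
    with h | h
  · exact (hΨ.mono hvT h).trans (le_max_right _ _)
  · obtain ⟨h1, h2⟩ := hcd.scale_le hT h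
    have h3 := hβle _ _ T ((hΘ.nonneg hD).trans_lt h1) ((hΘ.nonneg hD).trans_lt h) h2
    refine (hΨ.mono hvT (h3.trans ?_)).trans (le_max_left _ _)
    rw [← hξ0]
    exact (hβ.classK T hT).mono ((hΘ.nonneg hD).trans h1.le) (hupp (ξ 0))

end Estimate

/-! ### Carathéodory solutions -/

section Picard

variable {X : Type*} [NormedAddCommGroup X]

/-- A Carathéodory right-hand side that is, on bounded time intervals, uniformly bounded and
uniformly Lipschitz in the state. -/
structure IsLipschitzCaratheodory (F : ℝ → X → X) : Prop where
  aestronglyMeasurable : ∀ η : ℝ → X, Continuous η →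
    AEStronglyMeasurable (fun s => F s (η s)) volume
  bound : ∀ T : ℝ, ∃ L M : ℝ, 0 < L ∧ 0 ≤ M ∧ ∀ᵐ t, t ≤ T →
    (∀ x y, ‖F t x - F t y‖ ≤ L * ‖x - y‖) ∧ ∀ x, ‖F t x‖ ≤ M

/-- Picard iterates of `ξ' = F (t, ξ)`. -/
noncomputable def picardIterate [NormedSpace ℝ X] (F : ℝ → X → X) (ξ₀ : X) : ℕ → ℝ → X
  | 0 => fun _ => ξ₀
  | k + 1 => fun t => ξ₀ + ∫ s in (0 : ℝ)..t, F s (picardIterate F ξ₀ k s)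

namespace IsLipschitzCaratheodory

variable {F : ℝ → X → X}

theorem intervalIntegrable (hF : IsLipschitzCaratheodory F) {η : ℝ → X} (hη : Continuous η)
    (a b : ℝ) : IntervalIntegrable (fun s => F s (η s)) volume a b := by
  obtain ⟨L, M, -, -, h⟩ := hF.bound (max a b)
  rw [intervalIntegrable_iff]
  refine Measure.integrableOn_of_bounded (M := M) (by simp) (hF.aestronglyMeasurable η hη) ?_
  rw [ae_restrict_iff' measurableSet_uIoc]
  filter_upwards [h] with t ht ht'
  exact (ht ht'.2).2 _

variable [NormedSpace ℝ X]

theorem continuous_picardIterate (hF : IsLipschitzCaratheodory F) (ξ₀ : X) (k : ℕ) :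
    Continuous (picardIterate F ξ₀ k) := by
  induction k with
  | zero => exact continuous_const
  | succ k ih =>
    exact continuous_const.add (intervalIntegral.continuous_primitive (hF.intervalIntegrable ih) 0)

/-- With the weight `exp (2 L t)`, integrating a Lipschitz difference gains a factor `1 / 2`, so the
iterates contract on the whole interval whatever its length. -/
theorem dist_picardIterate_le (hF : IsLipschitzCaratheodory F) (ξ₀ : X) (T : ℝ) :
    ∃ C, 0 ≤ C ∧ ∀ k, ∀ t ∈ Icc 0 T,
      dist (picardIterate F ξ₀ k t) (picardIterate F ξ₀ (k + 1) t) ≤ C * (1 / 2) ^ k := by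
  rcases lt_or_ge T 0 with hT | hT
  · exact ⟨0, le_rfl, fun k t ht => absurd (ht.1.trans ht.2) hT.not_ge⟩
  obtain ⟨L, M, hL, hM, h⟩ := hF.bound T
  have key : ∀ k, ∀ t ∈ Icc 0 T, ‖picardIterate F ξ₀ (k + 1) t - picardIterate F ξ₀ k t‖ ≤
      M * T * (1 / 2) ^ k * Real.exp (2 * L * t) := by
    intro k
    induction k with
    | zero =>
      intro t ht
      have h1 := intervalIntegral.norm_integral_le_of_norm_le_const_ae (a := 0) (b := t)
        (f := fun s => F s ξ₀) (C := M) (by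
          filter_upwards [h] with s hs hs'
          rw [uIoc_of_le ht.1] at hs'
          exact (hs (hs'.2.trans ht.2)).2 _)
      rw [sub_zero, abs_of_nonneg ht.1] at h1
      have h2 : 1 ≤ Real.exp (2 * L * t) := Real.one_le_exp (by have := ht.1; positivity)
      have h3 : M * t ≤ M * T := mul_le_mul_of_nonneg_left ht.2 hM
      simp only [picardIterate, add_sub_cancel_left, pow_zero, mul_one]
      nlinarith [mul_nonneg hM hT]
    | succ k ih =>
      intro t ht
      set c := M * T * (1 / 2) ^ k
      have hc : 0 ≤ c := by positivity
      have h1 : picardIterate F ξ₀ (k + 1 + 1) t - picardIterate F ξ₀ (k + 1) t =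
          ∫ s in (0 : ℝ)..t, (F s (picardIterate F ξ₀ (k + 1) s) - F s (picardIterate F ξ₀ k s)) := by
        rw [intervalIntegral.integral_sub
          (hF.intervalIntegrable (hF.continuous_picardIterate ξ₀ _) 0 t)
          (hF.intervalIntegrable (hF.continuous_picardIterate ξ₀ _) 0 t)]
        simp only [picardIterate, add_sub_add_left_eq_sub]
      have h2 : ∫ s in (0 : ℝ)..t, L * (c * Real.exp (2 * L * s)) =
          c / 2 * Real.exp (2 * L * t) - c / 2 * Real.exp (2 * L * 0) := by
        refine intervalIntegral.integral_eq_sub_of_hasDerivAt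
          (f := fun s => c / 2 * Real.exp (2 * L * s)) (fun s _ => ?_)
          (Continuous.intervalIntegrable (by fun_prop) _ _)
        have h3 := (((hasDerivAt_id s).const_mul (2 * L)).exp).const_mul (c / 2)
        refine h3.congr_deriv ?_
        simp only [id]
        ring
      rw [h1]
      have h4 := intervalIntegral.norm_integral_le_of_norm_le (μ := volume) (a := 0) (b := t)
        (f := fun s => F s (picardIterate F ξ₀ (k + 1) s) - F s (picardIterate F ξ₀ k s))
        (g := fun s => L * (c * Real.exp (2 * L * s))) ht.1 (by
          filter_upwards [h] with s hs hs'
          refine ((hs (hs'.2.trans ht.2)).1 _ _).trans (mul_le_mul_of_nonneg_left ?_ hL.le)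
          exact ih s ⟨hs'.1.le, hs'.2.trans ht.2⟩)
        (Continuous.intervalIntegrable (by fun_prop) _ _)
      refine h4.trans ?_
      rw [h2]
      have h5 : M * T * (1 / 2) ^ (k + 1) = c / 2 := by simp only [c]; ring
      rw [h5]
      have : 0 ≤ c / 2 * Real.exp (2 * L * 0) := by positivity
      linarith
  refine ⟨M * T * Real.exp (2 * L * T), by positivity, fun k t ht => ?_⟩
  rw [dist_eq_norm']
  refine (key k t ht).trans ?_
  have h1 : Real.exp (2 * L * t) ≤ Real.exp (2 * L * T) :=
    Real.exp_le_exp.2 (mul_le_mul_of_nonneg_left ht.2 (by positivity))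
  have h2 : M * T * (1 / 2) ^ k * Real.exp (2 * L * t) ≤
      M * T * (1 / 2) ^ k * Real.exp (2 * L * T) := mul_le_mul_of_nonneg_left h1 (by positivity)
  linarith

/-- Global existence by Picard iteration. -/
theorem exists_eq_integral [CompleteSpace X] (hF : IsLipschitzCaratheodory F) (ξ₀ : X) :
    ∃ ξ : ℝ → X, Continuous ξ ∧ ∀ t, 0 ≤ t → ξ t = ξ₀ + ∫ s in (0 : ℝ)..t, F s (ξ s) := by
  have hlim : ∀ t : ℝ, ∃ y, 0 ≤ t → Tendsto (fun k => picardIterate F ξ₀ k t) atTop (𝓝 y) := by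
    intro t
    obtain ⟨C, -, hC⟩ := hF.dist_picardIterate_le ξ₀ t
    by_cases ht : 0 ≤ t
    · obtain ⟨y, hy⟩ := cauchySeq_tendsto_of_complete
        (cauchySeq_of_le_geometric (1 / 2) C (by norm_num) fun k => hC k t ⟨ht, le_rfl⟩)
      exact ⟨y, fun _ => hy⟩
    · exact ⟨0, fun h => absurd h ht⟩
  choose ζ hζ using hlim
  have hζc : ContinuousOn ζ (Ici 0) := by
    have hT (T : ℝ) : ContinuousOn ζ (Icc 0 T) := by
      obtain ⟨C, hC0, hC⟩ := hF.dist_picardIterate_le ξ₀ T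
      refine TendstoUniformlyOn.continuousOn (F := fun k t => picardIterate F ξ₀ k t) (p := atTop)
        ?_ (Eventually.of_forall fun k => (hF.continuous_picardIterate ξ₀ k).continuousOn).frequently
      rw [Metric.tendstoUniformlyOn_iff]
      intro ε hε
      have hz : Tendsto (fun k : ℕ => C * (1 / 2 : ℝ) ^ k / (1 - 1 / 2)) atTop (𝓝 0) := by
        have := ((tendsto_pow_atTop_nhds_zero_of_lt_one (r := (1 / 2 : ℝ)) (by norm_num)
          (by norm_num)).const_mul C).div_const (1 - 1 / 2)
        simpa using this
      filter_upwards [hz.eventually_lt_const hε] with k hk t ht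
      rw [dist_comm]
      exact (dist_le_of_le_geometric_of_tendsto (1 / 2) C (by norm_num) (fun k => hC k t ht)
        (hζ t ht.1) k).trans_lt hk
    intro t ht
    refine ((hT (t + 1)) t ⟨ht, by linarith⟩).mono_of_mem_nhdsWithin ?_
    rw [← Ici_inter_Iic]
    exact inter_mem_nhdsWithin _ (Iic_mem_nhds (by linarith))
  -- The limits are meaningful only for `t ≥ 0`; a constant extension to negative times gives a
  -- continuous curve on `ℝ`.
  let ξ : ℝ → X := fun t => ζ (max t 0)
  have hξc : Continuous ξ :=
    hζc.comp_continuous (continuous_id.max continuous_const) fun t => le_max_right t 0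
  have hξζ {t : ℝ} (ht : 0 ≤ t) : Tendsto (fun k => picardIterate F ξ₀ k t) atTop (𝓝 (ξ t)) := by
    simp only [ξ, max_eq_left ht]
    exact hζ t ht
  refine ⟨ξ, hξc, fun t ht => ?_⟩
  obtain ⟨L, M, hL, hM, h⟩ := hF.bound t
  have h1 : Tendsto (fun k => ∫ s in (0 : ℝ)..t, F s (picardIterate F ξ₀ k s)) atTop
      (𝓝 (∫ s in (0 : ℝ)..t, F s (ξ s))) := by
    refine intervalIntegral.tendsto_integral_filter_of_dominated_convergence (fun _ => M)
      (Eventually.of_forall fun k =>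
        (hF.aestronglyMeasurable _ (hF.continuous_picardIterate ξ₀ k)).restrict)
      (Eventually.of_forall fun k => ?_) intervalIntegrable_const ?_
    · filter_upwards [h] with s hs hs'
      rw [uIoc_of_le ht] at hs'
      exact (hs hs'.2).2 _
    · filter_upwards [h] with s hs hs'
      rw [uIoc_of_le ht] at hs'
      rw [tendsto_iff_norm_sub_tendsto_zero]
      have h2 := (tendsto_iff_norm_sub_tendsto_zero.1 (hξζ hs'.1.le)).const_mul L
      rw [mul_zero] at h2
      exact squeeze_zero (fun _ => norm_nonneg _) (fun k => (hs hs'.2).1 _ _) h2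
  exact tendsto_nhds_unique ((tendsto_add_atTop_iff_nat 1).2 (hξζ ht)) (h1.const_add ξ₀)

end IsLipschitzCaratheodory

end Picard

/-! ### Global existence from an a priori bound -/

section Cutoff

variable {X U : Type*} [NormedAddCommGroup X] [NormedSpace ℝ X]

/-- The right-hand side `f (x, u t)`, cut off smoothly in `x` outside of the ball of radius
`ρ t + 1`. -/
noncomputable def cutoffField (f : X → U → X) (u : ℝ → U) (ρ : ℝ → ℝ) (t : ℝ) (x : X) : X :=
  max 0 (min 1 (ρ t + 2 - ‖x‖)) • f x (u t)

theorem cutoffField_of_norm_le {f : X → U → X} {u : ℝ → U} {ρ : ℝ → ℝ} {t : ℝ} {x : X}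
    (hx : ‖x‖ ≤ ρ t + 1) : cutoffField f u ρ t x = f x (u t) := by
  rw [cutoffField, min_eq_left (by linarith), max_eq_right zero_le_one, one_smul]

theorem cutoffField_of_le_norm {f : X → U → X} {u : ℝ → U} {ρ : ℝ → ℝ} {t : ℝ} {x : X}
    (hx : ρ t + 2 ≤ ‖x‖) : cutoffField f u ρ t x = 0 := by
  rw [cutoffField, max_eq_left ((min_le_right _ _).trans (by linarith)), zero_smul]

variable [NormedAddCommGroup U]

/-- The cutoff is `1`-Lipschitz with values in `[0, 1]`. Monotonicity of `ρ` confines its support,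
for all times up to `T`, to one ball, on which `f` is bounded and Lipschitz. -/
theorem isLipschitzCaratheodory_cutoffField {f : X → U → X}
    (hlip : ∀ R, ∃ L, ∀ x y u, ‖x‖ ≤ R → ‖y‖ ≤ R → ‖u‖ ≤ R → ‖f x u - f y u‖ ≤ L * ‖x - y‖)
    (hbdd : ∀ R, ∃ M, ∀ x u, ‖x‖ ≤ R → ‖u‖ ≤ R → ‖f x u‖ ≤ M)
    {u : ℝ → U} (hu : ∀ T : ℝ, ∃ N, ∀ᵐ t, t ≤ T → ‖u t‖ ≤ N)
    (hmeas : ∀ η : ℝ → X, Continuous η → AEStronglyMeasurable (fun t => f (η t) (u t)) volume)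
    {ρ : ℝ → ℝ} (hρ : Monotone ρ) : IsLipschitzCaratheodory (cutoffField f u ρ) := by
  refine ⟨fun η hη => ?_, fun T => ?_⟩
  · have h1 : Measurable fun t => max 0 (min 1 (ρ t + 2 - ‖η t‖)) :=
      measurable_const.max (measurable_const.min
        ((hρ.measurable.add_const 2).sub hη.norm.measurable))
    exact h1.aestronglyMeasurable.smul (hmeas η hη)
  · obtain ⟨N, hN⟩ := hu T
    obtain ⟨L, hL⟩ := hlip (max (ρ T + 2) N)
    obtain ⟨M, hM⟩ := hbdd (max (ρ T + 2) N)
    -- `|L|` comes from varying `f`, `|M|` from varying the cutoff; the `1` only ensures positivity.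
    refine ⟨|L| + |M| + 1, |M|, by positivity, abs_nonneg M, ?_⟩
    filter_upwards [hN] with t ht htT
    have huN : ‖u t‖ ≤ max (ρ T + 2) N := (ht htT).trans (le_max_right _ _)
    have hball {x : X} (hx : ‖x‖ < ρ t + 2) : ‖x‖ ≤ max (ρ T + 2) N :=
      (hx.le.trans (by linarith [hρ htT])).trans (le_max_left _ _)
    have hfM {x : X} (hx : ‖x‖ < ρ t + 2) : ‖f x (u t)‖ ≤ |M| :=
      (hM x _ (hball hx) huN).trans (le_abs_self M)
    set c : X → ℝ := fun x => max 0 (min 1 (ρ t + 2 - ‖x‖))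
    have hc0 (x : X) : 0 ≤ c x := le_max_left _ _
    have hc1 (x : X) : c x ≤ 1 := max_le zero_le_one (min_le_left _ _)
    have hcl (x y : X) : |c x - c y| ≤ ‖x - y‖ := by
      have h1 : |c x - c y| ≤ |min 1 (ρ t + 2 - ‖x‖) - min 1 (ρ t + 2 - ‖y‖)| := by
        have := abs_max_sub_max_le_max 0 (min 1 (ρ t + 2 - ‖x‖)) 0 (min 1 (ρ t + 2 - ‖y‖))
        simpa using this
      have h2 : |min 1 (ρ t + 2 - ‖x‖) - min 1 (ρ t + 2 - ‖y‖)| ≤ |‖y‖ - ‖x‖| := by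
        have := abs_min_sub_min_le_max 1 (ρ t + 2 - ‖x‖) 1 (ρ t + 2 - ‖y‖)
        simpa using this
      refine h1.trans (h2.trans ?_)
      rw [abs_sub_comm]
      exact abs_norm_sub_norm_le x y
    -- Here `y` may lie where `f` has no available Lipschitz bound. Since the cutoff vanishes at
    -- `y`, its value at `x` is at most `‖x - y‖`, and bounding `f` at `x` suffices.
    have hone {x y : X} (hx : ‖x‖ < ρ t + 2) (hy : ρ t + 2 ≤ ‖y‖) :
        ‖cutoffField f u ρ t x - cutoffField f u ρ t y‖ ≤ (|L| + |M| + 1) * ‖x - y‖ := by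
      have hcy : c y = 0 := max_eq_left ((min_le_right _ _).trans (by linarith))
      rw [cutoffField_of_le_norm hy, sub_zero]
      have h1 := hcl x y
      rw [hcy, sub_zero] at h1
      have h2 : ‖cutoffField f u ρ t x‖ = |c x| * ‖f x (u t)‖ := norm_smul _ _
      have h3 := mul_le_mul h1 (hfM hx) (norm_nonneg _) (norm_nonneg _)
      rw [h2]
      nlinarith [norm_nonneg (x - y), abs_nonneg L]
    refine ⟨fun x y => ?_, fun x => ?_⟩
    · rcases lt_or_ge ‖x‖ (ρ t + 2) with hx | hx <;> rcases lt_or_ge ‖y‖ (ρ t + 2) with hy | hy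
      · have h1 : cutoffField f u ρ t x - cutoffField f u ρ t y =
            c x • (f x (u t) - f y (u t)) + (c x - c y) • f y (u t) := by
          simp only [cutoffField, c, smul_sub, sub_smul]
          abel
        have h2 : ‖c x • (f x (u t) - f y (u t))‖ ≤ |L| * ‖x - y‖ := by
          rw [norm_smul, Real.norm_of_nonneg (hc0 x)]
          have h3 := (hL x y _ (hball hx) (hball hy) huN).trans
            (mul_le_mul_of_nonneg_right (le_abs_self L) (norm_nonneg _))
          exact (mul_le_of_le_one_left (norm_nonneg _) (hc1 x)).trans h3
        have h4 : ‖(c x - c y) • f y (u t)‖ ≤ ‖x - y‖ * |M| := by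
          rw [norm_smul]
          exact mul_le_mul (hcl x y) (hfM hy) (norm_nonneg _) (norm_nonneg _)
        rw [h1]
        refine (norm_add_le _ _).trans ?_
        nlinarith [norm_nonneg (x - y)]
      · exact hone hx hy
      · rw [norm_sub_rev, norm_sub_rev x]
        exact hone hy hx
      · rw [cutoffField_of_le_norm hx, cutoffField_of_le_norm hy, sub_zero, norm_zero]
        positivity
    · rcases lt_or_ge ‖x‖ (ρ t + 2) with hx | hx
      · have h2 : ‖cutoffField f u ρ t x‖ = ‖c x‖ * ‖f x (u t)‖ := norm_smul _ _
        rw [h2, Real.norm_of_nonneg (hc0 x)]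
        exact (mul_le_of_le_one_left (norm_nonneg _) (hc1 x)).trans (hfM hx)
      · rw [cutoffField_of_le_norm hx, norm_zero]
        exact abs_nonneg M

/-- A system whose solutions obey an a priori bound has solutions on `[0, ∞)`. -/
theorem exists_isSolution_of_norm_le [CompleteSpace X] {f : X → U → X}
    (hlip : ∀ R, ∃ L, ∀ x y u, ‖x‖ ≤ R → ‖y‖ ≤ R → ‖u‖ ≤ R → ‖f x u - f y u‖ ≤ L * ‖x - y‖)
    (hbdd : ∀ R, ∃ M, ∀ x u, ‖x‖ ≤ R → ‖u‖ ≤ R → ‖f x u‖ ≤ M)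
    {u : ℝ → U} (hu : ∀ T : ℝ, ∃ N, ∀ᵐ t, t ≤ T → ‖u t‖ ≤ N)
    (hmeas : ∀ η : ℝ → X, Continuous η → AEStronglyMeasurable (fun t => f (η t) (u t)) volume)
    {ρ : ℝ → ℝ} (hρ : Monotone ρ) {ξ₀ : X}
    (hest : ∀ T ξ, 0 ≤ T → IsSolutionOn f u ξ₀ T ξ → ‖ξ T‖ ≤ ρ T) : ∃ ξ, IsSolution f u ξ₀ ξ := by
  have hF := isLipschitzCaratheodory_cutoffField hlip hbdd hu hmeas hρ
  obtain ⟨ξ, hξc, hξ⟩ := hF.exists_eq_integral ξ₀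
  -- The endpoint `T` is a null set and may be omitted, which allows `T` to be the infimum of the
  -- bad times below.
  have hsol {T : ℝ} (hT : ∀ s ∈ Ico 0 T, ‖ξ s‖ ≤ ρ s + 1) : IsSolutionOn f u ξ₀ T ξ := by
    refine ⟨hξc.continuousOn, fun t ht => ?_⟩
    have hae : ∀ᵐ s, s ∈ uIoc 0 t → cutoffField f u ρ s (ξ s) = f (ξ s) (u s) := by
      filter_upwards [Measure.ae_ne volume T] with s hsT hs
      rw [uIoc_of_le ht.1] at hs
      exact cutoffField_of_norm_le (hT s ⟨hs.1.le, (hs.2.trans ht.2).lt_of_ne hsT⟩)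
    refine ⟨(hF.intervalIntegrable hξc 0 t).congr_ae ?_, ?_⟩
    · rwa [EventuallyEq, ae_restrict_iff' measurableSet_uIoc]
    · rw [hξ t ht.1, intervalIntegral.integral_congr_ae hae]
  -- First exit: up to the infimum of the bad times the curve solves the original system, so there
  -- the norm is at most `ρ`. The margin `1`, continuity and monotonicity of `ρ` exclude bad times
  -- shortly after.
  have hgood : ∀ t, 0 ≤ t → ‖ξ t‖ ≤ ρ t + 1 := by
    by_contra! hcon
    set B : Set ℝ := {t | 0 ≤ t ∧ ρ t + 1 < ‖ξ t‖}
    have hB : B.Nonempty := hcon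
    have hBb : BddBelow B := ⟨0, fun t ht => ht.1⟩
    have ht0 : 0 ≤ sInf B := le_csInf hB fun t ht => ht.1
    have h1 := hest _ ξ ht0 (hsol fun s hs => by
      by_contra! h
      exact hs.2.not_ge (csInf_le hBb ⟨hs.1, h⟩))
    have h2 : ∀ᶠ s in 𝓝 (sInf B), ‖ξ s‖ < ρ (sInf B) + 1 :=
      hξc.norm.continuousAt.eventually_lt_const (by linarith)
    obtain ⟨δ, hδ, h2⟩ := Metric.eventually_nhds_iff.1 h2
    obtain ⟨t, ht, htδ⟩ := exists_lt_of_csInf_lt hB (lt_add_of_pos_right (sInf B) hδ)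
    have h3 : sInf B ≤ t := csInf_le hBb ht
    have h4 := h2 (y := t) (by rw [Real.dist_eq, abs_of_nonneg (sub_nonneg.2 h3)]; linarith)
    linarith [hρ h3, ht.2]
  refine ⟨ξ, hξc.continuousOn, fun t ht => ?_⟩
  exact (hsol fun s hs => hgood s hs.1).2 t ⟨ht, le_rfl⟩

end Cutoff

/-! ### The coupled system -/

theorem IsRegularDynamics.continuous_state {k l i j : ℕ} {g : Euc k → Euc l → Euc i → Euc j}
    (hg : IsRegularDynamics g) (u : Euc i) : Continuous fun y : Euc k × Euc l => g y.1 y.2 u := by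
  rw [continuous_iff_continuousAt]
  rintro ⟨a, b⟩
  obtain ⟨L, hL⟩ := hg.lipschitz (max (‖a‖ + 1) (max (‖b‖ + 1) ‖u‖))
  rw [ContinuousAt, tendsto_iff_norm_sub_tendsto_zero]
  have h1 : Tendsto (fun y : Euc k × Euc l => L * (‖y.1 - a‖ + ‖y.2 - b‖)) (𝓝 (a, b)) (𝓝 0) := by
    have : Continuous fun y : Euc k × Euc l => L * (‖y.1 - a‖ + ‖y.2 - b‖) := by fun_prop
    simpa using this.tendsto (a, b)
  refine squeeze_zero' (Eventually.of_forall fun _ => norm_nonneg _) ?_ h1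
  have ha : ∀ᶠ y : Euc k × Euc l in 𝓝 (a, b), ‖y.1‖ < ‖a‖ + 1 :=
    (continuous_fst.norm.tendsto (a, b)).eventually_lt_const (lt_add_one ‖a‖)
  have hb : ∀ᶠ y : Euc k × Euc l in 𝓝 (a, b), ‖y.2‖ < ‖b‖ + 1 :=
    (continuous_snd.norm.tendsto (a, b)).eventually_lt_const (lt_add_one ‖b‖)
  filter_upwards [ha, hb] with y hya hyb
  have hR1 := le_max_left (‖a‖ + 1) (max (‖b‖ + 1) ‖u‖)
  have hR2 := le_max_right (‖a‖ + 1) (max (‖b‖ + 1) ‖u‖)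
  have hR3 := (le_max_left (‖b‖ + 1) ‖u‖).trans hR2
  exact hL y.1 a y.2 b u (hya.le.trans hR1) (by linarith) (hyb.le.trans hR3) (by linarith)
    ((le_max_right _ _).trans hR2)

/-- A map continuous in the state and measurable in the input is jointly measurable, so substituting
a continuous curve and a measurable input preserves measurability. -/
theorem IsRegularDynamics.aestronglyMeasurable {k l i j : ℕ}
    {g : Euc k → Euc l → Euc i → Euc j} (hg : IsRegularDynamics g) {a : ℝ → Euc k} {b : ℝ → Euc l}
    {u : ℝ → Euc i} (ha : Continuous a) (hb : Continuous b) (hu : AEStronglyMeasurable u volume) :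
    AEStronglyMeasurable (fun t => g (a t) (b t) (u t)) volume := by
  have h1 : StronglyMeasurable
      (Function.uncurry fun (y : Euc k × Euc l) (v : Euc i) => g y.1 y.2 v) :=
    stronglyMeasurable_uncurry_of_continuous_of_stronglyMeasurable hg.continuous_state
      fun y => (hg.measurable_input y.1 y.2).stronglyMeasurable
  have h2 : AEMeasurable (fun t => ((a t, b t), u t)) volume :=
    ((ha.prodMk hb).measurable.aemeasurable).prodMk hu.aemeasurable
  exact h1.aestronglyMeasurable.comp_aemeasurable h2

section PerturbedSystem

variable {n m p q : ℕ} {gs : Euc n → Euc m → Euc p → Euc n} {gf : Euc m → Euc n → Euc q → Euc m}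

theorem norm_pair_smul_le {cs cf A B : ℝ} {a : Euc n} {b : Euc m} (ha : ‖a‖ ≤ A) (hb : ‖b‖ ≤ B) :
    ‖pair (cs • a) (cf • b)‖ ≤ |cs| * A + |cf| * B := by
  refine (norm_le_norm_fst_add_norm_snd _).trans (add_le_add ?_ ?_)
  · exact (norm_smul _ _).le.trans (mul_le_mul_of_nonneg_left ha (abs_nonneg cs))
  · exact (norm_smul _ _).le.trans (mul_le_mul_of_nonneg_left hb (abs_nonneg cf))

theorem perturbedSystem_lipschitz (hgs : IsRegularDynamics gs) (hgf : IsRegularDynamics gf)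
    (cs cf R : ℝ) : ∃ L, ∀ (x y : WithLp 2 (Euc n × Euc m)) (u : WithLp 2 (Euc p × Euc q)),
      ‖x‖ ≤ R → ‖y‖ ≤ R → ‖u‖ ≤ R →
        ‖perturbedSystem (fun _ _ _ => cs) (fun _ _ _ => cf) gs gf x u -
          perturbedSystem (fun _ _ _ => cs) (fun _ _ _ => cf) gs gf y u‖ ≤ L * ‖x - y‖ := by
  obtain ⟨L₁, hL₁⟩ := hgs.lipschitz R
  obtain ⟨L₂, hL₂⟩ := hgf.lipschitz R
  refine ⟨|cs| * (|L₁| * 2) + |cf| * (|L₂| * 2), fun x y u hx hy hu => ?_⟩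
  have hfst (v : WithLp 2 (Euc n × Euc m)) : ‖v.fst‖ ≤ ‖v‖ := WithLp.norm_fst_le _ v
  have hsnd (v : WithLp 2 (Euc n × Euc m)) : ‖v.snd‖ ≤ ‖v‖ := WithLp.norm_snd_le _ v
  have hxy1 : ‖x.fst - y.fst‖ ≤ ‖x - y‖ := hfst (x - y)
  have hxy2 : ‖x.snd - y.snd‖ ≤ ‖x - y‖ := hsnd (x - y)
  have h1 : ‖gs x.fst x.snd u.fst - gs y.fst y.snd u.fst‖ ≤ |L₁| * 2 * ‖x - y‖ := by
    refine (hL₁ _ _ _ _ _ ((hfst x).trans hx) ((hfst y).trans hy) ((hsnd x).trans hx)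
      ((hsnd y).trans hy) ((WithLp.norm_fst_le _ u).trans hu)).trans ?_
    rw [mul_assoc]
    exact mul_le_mul (le_abs_self _) (by linarith) (by positivity) (abs_nonneg _)
  have h2 : ‖gf x.snd x.fst u.snd - gf y.snd y.fst u.snd‖ ≤ |L₂| * 2 * ‖x - y‖ := by
    refine (hL₂ _ _ _ _ _ ((hsnd x).trans hx) ((hsnd y).trans hy) ((hfst x).trans hx)
      ((hfst y).trans hy) ((WithLp.norm_snd_le _ u).trans hu)).trans ?_
    rw [mul_assoc]
    exact mul_le_mul (le_abs_self _) (by linarith) (by positivity) (abs_nonneg _)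
  have h3 : perturbedSystem (fun _ _ _ => cs) (fun _ _ _ => cf) gs gf x u -
      perturbedSystem (fun _ _ _ => cs) (fun _ _ _ => cf) gs gf y u =
      pair (cs • (gs x.fst x.snd u.fst - gs y.fst y.snd u.fst))
        (cf • (gf x.snd x.fst u.snd - gf y.snd y.fst u.snd)) := by
    rw [smul_sub, smul_sub]
    rfl
  rw [h3]
  refine (norm_pair_smul_le h1 h2).trans (le_of_eq ?_)
  ring

theorem perturbedSystem_bounded (hgs : IsRegularDynamics gs) (hgf : IsRegularDynamics gf)
    (cs cf R : ℝ) : ∃ M, ∀ (x : WithLp 2 (Euc n × Euc m)) (u : WithLp 2 (Euc p × Euc q)),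
      ‖x‖ ≤ R → ‖u‖ ≤ R →
        ‖perturbedSystem (fun _ _ _ => cs) (fun _ _ _ => cf) gs gf x u‖ ≤ M := by
  obtain ⟨M₁, hM₁⟩ := hgs.exists_norm_le R
  obtain ⟨M₂, hM₂⟩ := hgf.exists_norm_le R
  refine ⟨|cs| * M₁ + |cf| * M₂, fun x u hx hu => norm_pair_smul_le ?_ ?_⟩
  · exact hM₁ _ _ _ ((WithLp.norm_fst_le _ x).trans hx) ((WithLp.norm_snd_le _ x).trans hx)
      ((WithLp.norm_fst_le _ u).trans hu)
  · exact hM₂ _ _ _ ((WithLp.norm_snd_le _ x).trans hx) ((WithLp.norm_fst_le _ x).trans hx)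
      ((WithLp.norm_snd_le _ u).trans hu)

theorem perturbedSystem_aestronglyMeasurable (hgs : IsRegularDynamics gs)
    (hgf : IsRegularDynamics gf) (cs cf : ℝ) {u : ℝ → WithLp 2 (Euc p × Euc q)}
    (hu : AEStronglyMeasurable u volume) {η : ℝ → WithLp 2 (Euc n × Euc m)} (hη : Continuous η) :
    AEStronglyMeasurable
      (fun t => perturbedSystem (fun _ _ _ => cs) (fun _ _ _ => cf) gs gf (η t) (u t)) volume := by
  have he := (WithLp.prodContinuousLinearEquiv 2 ℝ (Euc n) (Euc m)).continuous.comp hη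
  have hue := (WithLp.prodContinuousLinearEquiv 2 ℝ (Euc p) (Euc q)).continuous
  have h1 : Continuous fun t => (η t).fst := continuous_fst.comp he
  have h2 : Continuous fun t => (η t).snd := continuous_snd.comp he
  have h3 : AEStronglyMeasurable (fun t => (u t).fst) volume :=
    (continuous_fst.comp hue).comp_aestronglyMeasurable hu
  have h4 : AEStronglyMeasurable (fun t => (u t).snd) volume :=
    (continuous_snd.comp hue).comp_aestronglyMeasurable hu
  exact (WithLp.prodContinuousLinearEquiv 2 ℝ (Euc n) (Euc m)).symm.continuous.comp_aestronglyMeasurable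
    (((hgs.aestronglyMeasurable h1 h2 h3).const_smul cs).prodMk
      ((hgf.aestronglyMeasurable h2 h1 h4).const_smul cf))

end PerturbedSystem

/-! ### From the finite-horizon estimate to input-to-state stability -/

theorem ae_norm_le_toReal_eLpNorm_top {U : Type*} [NormedAddCommGroup U] {u : ℝ → U} {S : Set ℝ}
    (hS : MeasurableSet S) (hu : eLpNorm u ⊤ (volume.restrict S) < ⊤) :
    ∀ᵐ t, t ∈ S → ‖u t‖ ≤ (eLpNorm u ⊤ (volume.restrict S)).toReal := by
  rw [← ae_restrict_iff' hS]
  filter_upwards [ae_le_eLpNormEssSup (f := u) (μ := volume.restrict S)] with t ht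
  rw [← eLpNorm_exponent_top] at ht
  have := ENNReal.toReal_mono hu.ne ht
  rwa [toReal_enorm] at this

theorem IsSolution.isSolutionOn {X U : Type*} [NormedAddCommGroup X] [NormedSpace ℝ X]
    [NormedAddCommGroup U] {f : X → U → X} {u : ℝ → U} {ξ₀ : X} {ξ : ℝ → X}
    (h : IsSolution f u ξ₀ ξ) (T : ℝ) : IsSolutionOn f u ξ₀ T ξ :=
  ⟨h.1.mono Icc_subset_Ici_self, fun t ht => h.2 t ht.1⟩

/-- A system with a regular right-hand side whose solutions satisfy the estimate of input-to-state
stability on finite horizons is input-to-state stable. -/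
theorem isISS_of_estimate {X U : Type*} [NormedAddCommGroup X] [NormedSpace ℝ X]
    [CompleteSpace X] [NormedAddCommGroup U] {f : X → U → X} {ξₑ : X}
    (hlip : ∀ R, ∃ L, ∀ x y u, ‖x‖ ≤ R → ‖y‖ ≤ R → ‖u‖ ≤ R → ‖f x u - f y u‖ ≤ L * ‖x - y‖)
    (hbdd : ∀ R, ∃ M, ∀ x u, ‖x‖ ≤ R → ‖u‖ ≤ R → ‖f x u‖ ≤ M)
    (hmeas : ∀ u : ℝ → U, AEStronglyMeasurable u volume → ∀ η : ℝ → X, Continuous η →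
      AEStronglyMeasurable (fun t => f (η t) (u t)) volume)
    {β : ℝ → ℝ → ℝ} {χ : ℝ → ℝ} (hβ : IsClassKL β) (hχ : IsClassK χ)
    (hest : ∀ (ξ₀ : X) (u : ℝ → U) (T D : ℝ) (ξ : ℝ → X), 0 ≤ T → 0 ≤ D →
      (∀ᵐ t, t ∈ Icc 0 T → ‖u t‖ ≤ D) → IsSolutionOn f u ξ₀ T ξ →
        ‖ξ T - ξₑ‖ ≤ max (β ‖ξ₀ - ξₑ‖ T) (χ D)) :
    IsISS f ξₑ := by
  refine ⟨β, χ, hβ, hχ, fun ξ₀ u hu => ⟨?_, fun ξ hξ hfin t ht => ?_⟩⟩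
  -- The running essential supremum is finite even when the global one is not, so existence covers
  -- every admissible input.
  · set N : ℝ → ℝ := fun T => (eLpNorm u ⊤ (volume.restrict (Icc 0 T))).toReal
    have hN0 (T : ℝ) : 0 ≤ N T := ENNReal.toReal_nonneg
    have hN : Monotone N := fun T T' hTT' => ENNReal.toReal_mono (hu.2 T').ne
      (eLpNorm_mono_measure u (Measure.restrict_mono (Icc_subset_Icc_right hTT') le_rfl))
    have hNae (T : ℝ) : ∀ᵐ t, t ∈ Icc 0 T → ‖u t‖ ≤ N T :=
      ae_norm_le_toReal_eLpNorm_top measurableSet_Icc (hu.2 T)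
    -- The input is unconstrained at negative times; setting it to zero there gives measurability
    -- and bounds on all of `ℝ` without changing the equation on `[0, ∞)`.
    set v : ℝ → U := (Ici 0).indicator u
    have hvu {t : ℝ} (ht : 0 ≤ t) : v t = u t := indicator_of_mem (mem_Ici.2 ht) u
    have hv : AEStronglyMeasurable v volume :=
      (aestronglyMeasurable_indicator_iff measurableSet_Ici).2 hu.1
    have hvN (T : ℝ) : ∀ᵐ t, t ≤ T → ‖v t‖ ≤ N T := by
      filter_upwards [hNae T] with t ht htT
      rcases lt_or_ge t 0 with h0 | h0
      · have : v t = 0 := indicator_of_notMem (notMem_Ici.2 h0) u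
        rw [this, norm_zero]
        exact hN0 T
      · rw [hvu h0]
        exact ht ⟨h0, htT⟩
    have hβ0 {T : ℝ} (hT : 0 ≤ T) : β ‖ξ₀ - ξₑ‖ T ≤ β ‖ξ₀ - ξₑ‖ 0 := by
      rcases (norm_nonneg (ξ₀ - ξₑ)).eq_or_lt with h | h
      · rw [← h, (hβ.classK T hT).map_zero, (hβ.classK 0 le_rfl).map_zero]
      · exact hβ.antitoneOn _ h self_mem_Ici hT hT
    obtain ⟨ξ, hξ⟩ := exists_isSolution_of_norm_le (f := f) (u := v) (ξ₀ := ξ₀)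
      (ρ := fun T => ‖ξₑ‖ + max (β ‖ξ₀ - ξₑ‖ 0) (χ (N T))) hlip hbdd (fun T => ⟨N T, hvN T⟩)
      (hmeas v hv) (fun T T' hTT' => by
        have := hχ.mono (hN0 T) (hN hTT')
        exact add_le_add_right (max_le_max le_rfl this) _) (fun T ξ hT hξ => by
        have h1 := hest ξ₀ v T (N T) ξ hT (hN0 T)
          ((hvN T).mono fun t ht htT => ht htT.2) hξ
        have h2 : ‖ξ T‖ ≤ ‖ξ T - ξₑ‖ + ‖ξₑ‖ := norm_le_norm_sub_add _ _
        have h3 : max (β ‖ξ₀ - ξₑ‖ T) (χ (N T)) ≤ max (β ‖ξ₀ - ξₑ‖ 0) (χ (N T)) :=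
          max_le_max (hβ0 hT) le_rfl
        linarith)
    refine ⟨ξ, hξ.1, fun t ht => ?_⟩
    have hcongr : ∀ s ∈ uIoc 0 t, f (ξ s) (v s) = f (ξ s) (u s) := fun s hs => by
      rw [uIoc_of_le ht] at hs
      rw [hvu hs.1.le]
    obtain ⟨h1, h2⟩ := hξ.2 t ht
    refine ⟨h1.congr hcongr, ?_⟩
    rw [h2, intervalIntegral.integral_congr_ae (Eventually.of_forall hcongr)]
  · refine hest ξ₀ u t _ ξ ht ENNReal.toReal_nonneg ?_ (hξ.isSolutionOn t)
    filter_upwards [ae_norm_le_toReal_eLpNorm_top measurableSet_Ici hfin] with s hs hst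
    exact hs hst.1

theorem theorem2 {n m p q : ℕ}
    (gs : Euc n → Euc m → Euc p → Euc n) (gf : Euc m → Euc n → Euc q → Euc m)
    (hgs : IsRegularDynamics gs) (hgf : IsRegularDynamics gf)
    (φ : Euc n → Euc m) (hφ : IsSteadyStateMap gs gf φ)
    (Vs : Euc n → ℝ) (Vf : Euc m → Euc n → ℝ)
    (αsLow αsUp γs χs αs : ℝ → ℝ)
    (hs : IsSlowLyapunov gs Vs Vf αsLow αsUp γs χs αs)
    (αfLow αfUp χf αf l₁ l₂ : ℝ → ℝ)
    (hf : IsFastLyapunov gf φ Vs Vf αfLow αfUp χf αf l₁ l₂)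
    (hl₂ : MonotoneOn l₂ (Ici 0))
    (G : ℝ → ℝ) (hG : IsClassKInf G)
    (hgG : ∀ x z d, ‖gs x z d‖ ≤ G (‖x‖ + ‖z - φ x‖ + ‖d‖))
    (c₀ : ℝ) (hc₀ : 0 < c₀)
    (hcond : ∀ r, 0 < r → c₀ * gBar G αsLow αfLow γs χs r * lambdaBar l₁ l₂ γs r < αf r)
    (cs cf : ℝ) (hcs : 0 < cs) (hcf : 0 < cf) (hc : cs / cf = c₀) :
    IsISS (perturbedSystem (fun _ _ _ => cs) (fun _ _ _ => cf) gs gf) (pair 0 (φ 0)) := by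
  obtain ⟨β, χ, hβ, hχ, hest⟩ := exists_estimate_of_isSolutionOn hgs hgf
    hφ.locallyLipschitz.continuous hs hf hl₂ hG hgG hcond hcs hcf hc
  exact isISS_of_estimate (perturbedSystem_lipschitz hgs hgf cs cf)
    (perturbedSystem_bounded hgs hgf cs cf)
    (fun _ hu _ hη => perturbedSystem_aestronglyMeasurable hgs hgf cs cf hu hη) hβ hχ hest
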